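/- Let $K$ be a field. A weighted oriented graph $\mathcal D$ is a finite directed graph without loops and without pairs of opposite edges, together with a weight function $\omega : V(\mathcal D)\to\{1,2,3,\dots\}$. Its underlying graph is the simple graph obtained by forgetting the directions of the edges. A source is a non-isolated vertex with no incoming edges. The edge ideal of $\mathcal D$ is the monomial ideal $$I(\mathcal D) = \big(u\,v^{\omega(v)} \;\big|\; (u,v)\in E(\mathcal D)\big)$$ in the polynomial ring $R$ over $K$ whose variables are the vertices of $\mathcal D$, where $(u,v)$ denotes the edge directed from $u$ to $v$. For a monomial ideal $I$ let $\mathrm{gen}(I)$ be its set of minimal monomial generators. The polarization $I^{\mathrm{pol}}$ is generated by the squarefree monomials $\prod_i\prod_{j=1}^{a_i} z_{i,j}$ for $\prod_i z_i^{a_i}\in\mathrm{gen}(I)$, in the polynomial ring over $K$ in the variables $z_{i,j}$, $1\le j\le p_i$, where $p_i$ is the largest exponent of $z_i$ in $\mathrm{gen}(I)$. The Alexander dual of a squarefree monomial ideal $J$ is $J^\vee=\bigcap_{m\in\mathrm{gen}(J)}(z \mid z \text{ a variable dividing } m)$. The ideal $J$ has dual linear quotients if $\mathrm{gen}(J^\vee)$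 can be ordered as $m_1,\dots,m_\mu$ so that for each $i>1$ the colon ideal $(m_1,\dots,m_{i-1}):(m_i)$ is generated by variables. Let $G'$ be an arbitrary finite simple graph on the vertex set $\{x_1,\dots,x_r\}$, and let $G$ be obtained from $G'$ by adding whiskers $\{x_1,y_1\},\dots,\{x_r,y_r\}$, where $y_1,\dots,y_r$ are new vertices. Let $\mathcal D$ be a weighted oriented graph with underlying graph $G$ in which every source has weight $1$. Then the following are equivalent: (a) $\mathcal D$ is Cohen–Macaulay, that is, $R/I(\mathcal D)$ is a Cohen–Macaulay ring; (b) $I(\mathcal D)$ is unmixed, that is, all associated primes of $R/I(\mathcal D)$ have the same height; (c) $\omega(x_s)=1$ for every $s$ such that $(x_s,y_s)$, directed from $x_s$ to $y_s$, is an edge of $\mathcal D$. Moreover, each of these conditions implies (d) the polarization $I(\mathcal D)^{\mathrm{pol}}$ has dual linear quotients. -/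

import Mathlib

open MvPolynomial

/-! ### Cohen–Macaulay rings and unmixed ideals -/

/-- The depth of a local ring: the supremum of the lengths of regular sequences contained in the
maximal ideal. -/
noncomputable def localRingDepth (A : Type*) [CommRing A] [IsLocalRing A] : ℕ∞ :=
  ⨆ rs : {rs : List A // (∀ a ∈ rs, a ∈ IsLocalRing.maximalIdeal A) ∧
    RingTheory.Sequence.IsRegular A rs}, (rs.1.length : ℕ∞)

/-- A Noetherian ring all of whose local rings have depth equal to their Krull dimension. -/
def IsCohenMacaulayRing (A : Type*) [CommRing A] : Prop :=
  IsNoetherianRing A ∧ ∀ (p : Ideal A) [p.IsPrime],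
    (localRingDepth (Localization.AtPrime p) : WithBot ℕ∞) =
      ringKrullDim (Localization.AtPrime p)

/-- All the associated primes of `I` (i.e. of the module `R ⧸ I`) have the same height. -/
def Ideal.IsUnmixedIdeal {R : Type*} [CommRing R] (I : Ideal R) : Prop :=
  ∀ p ∈ associatedPrimes R (R ⧸ I), ∀ q ∈ associatedPrimes R (R ⧸ I), p.height = q.height

/-! ### Monomial ideals

Monomials are represented by their exponent vectors `a : σ →₀ ℕ`. -/

section Monomial

variable {K : Type*} [Field K] {σ : Type*}

/-- The exponent vectors of the monomials in `I` that are minimal with respect to divisibility;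
for a monomial ideal these are the exponents of its minimal monomial generators. -/
def minGens (I : Ideal (MvPolynomial σ K)) : Set (σ →₀ ℕ) :=
  {a | Minimal (fun b : σ →₀ ℕ => monomial b (1 : K) ∈ I) a}

/-- The largest exponent of the `i`-th variable in a minimal generator of `I`. -/
noncomputable def maxExponent (I : Ideal (MvPolynomial σ K)) (i : σ) : ℕ :=
  sSup ((fun a : σ →₀ ℕ => a i) '' minGens I)

/-- The polarization of a monomial ideal `I`. Each minimal generator `∏ i, x i ^ a i` is replaced
by the product of the variables `x i j` with `j < a i`, in the polynomial ring in the variables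
`x i j`, where `j < maxExponent I i` (the second index starts at `0`). -/
noncomputable def polarization [Fintype σ] (I : Ideal (MvPolynomial σ K)) :
    Ideal (MvPolynomial (Σ i : σ, Fin (maxExponent I i)) K) :=
  Ideal.span ((fun a : σ →₀ ℕ =>
    ∏ i : σ, ∏ j : Fin (maxExponent I i) with j.val < a i,
      (X ⟨i, j⟩ : MvPolynomial (Σ i : σ, Fin (maxExponent I i)) K)) '' minGens I)

/-- The Alexander dual of a squarefree monomial ideal: the intersection, over the minimal
generators, of the ideals generated by the variables dividing the generator. -/
noncomputable def alexanderDual (I : Ideal (MvPolynomial σ K)) : Ideal (MvPolynomial σ K) :=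
  ⨅ a ∈ minGens I, Ideal.span {f | ∃ i : σ, a i ≠ 0 ∧ f = X i}

/-- A monomial ideal has linear quotients if its minimal generators can be ordered as
`m 0, …, m (μ - 1)` such that each colon ideal `(m 0, …, m (t - 1)) : (m t)`, `t > 0`, is generated
by variables. -/
def HasLinearQuotients (I : Ideal (MvPolynomial σ K)) : Prop :=
  ∃ (μ : ℕ) (m : Fin μ → (σ →₀ ℕ)), Function.Injective m ∧ Set.range m = minGens I ∧
    ∀ t : Fin μ, 0 < t.val → ∃ s : Set σ,
      Submodule.colon (Ideal.span {f | ∃ u : Fin μ, u < t ∧ f = monomial (m u) (1 : K)})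
        (Ideal.span {monomial (m t) (1 : K)} : Ideal (MvPolynomial σ K)) =
      Ideal.span (X '' s : Set (MvPolynomial σ K))

/-- A squarefree monomial ideal has dual linear quotients if its Alexander dual has linear
quotients. -/
def HasDualLinearQuotients (I : Ideal (MvPolynomial σ K)) : Prop :=
  HasLinearQuotients (alexanderDual I)

end Monomial

/-! ### Weighted oriented graphs -/

/-- A vertex-weighted oriented graph: a digraph without loops and without pairs of opposite edges,
with a positive integer weight on every vertex. `Adj u v` means that `(u, v)`, directed from `u` to
`v`, is an edge. -/
structure WeightedOrientedGraph (W : Type*) extends Digraph W where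
  loopless : ∀ u, ¬ Adj u u
  asymm : ∀ u v, Adj u v → ¬ Adj v u
  weight : W → ℕ
  weight_pos : ∀ v, 0 < weight v

namespace WeightedOrientedGraph

variable {W : Type*} (D : WeightedOrientedGraph W)

/-- The underlying simple graph. -/
def underlyingGraph : SimpleGraph W := D.toDigraph.toSimpleGraphInclusive

/-- A source is a non-isolated vertex without in-neighbors. -/
def IsSource (v : W) : Prop := (∃ u, D.Adj v u) ∧ ∀ u, ¬ D.Adj u v

/-- The edge ideal, generated by the monomials `x u * x v ^ weight v` for the directed edges
`(u, v)`. -/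
noncomputable def edgeIdeal (K : Type*) [Field K] : Ideal (MvPolynomial W K) :=
  Ideal.span {f | ∃ u v, D.Adj u v ∧ f = X u * X v ^ D.weight v}

/-- The weighted oriented graph is Cohen–Macaulay (over `K`) if its quotient ring is. -/
def IsCohenMacaulay (K : Type*) [Field K] : Prop :=
  IsCohenMacaulayRing (MvPolynomial W K ⧸ D.edgeIdeal K)

end WeightedOrientedGraph

/-- The graph obtained from a graph on the vertices `x s` (here `Sum.inl s`) by attaching to each
`x s` a new leaf `y s` (here `Sum.inr s`). -/
def SimpleGraph.whiskerGraph {V : Type*} (G : SimpleGraph V) : SimpleGraph (V ⊕ V) :=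
  SimpleGraph.fromRel fun a b =>
    (∃ s t, G.Adj s t ∧ a = Sum.inl s ∧ b = Sum.inl t) ∨ ∃ s, a = Sum.inl s ∧ b = Sum.inr s

/-! Under (c) the tail of every whisker edge has weight 1: if the tail is `x_s` this is (c), and if
it is `y_s`, the leaf `y_s` is a source. So every whisker contributes the generator `x_s ^ ω(x_s) *
y_s ^ ω(y_s)`, and all other generators involve only the `x_s`.

(c) ⇒ (a): substitute `y_s = x_s + θ_s` and view the ring as `S[x]` with `S = K[θ]`. The whisker
generators become monic polynomials in the single variables `x_s`, so the quotient is integral over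
`S`. Reducing modulo these polynomials and killing the inner monomials is well defined on the
quotient (`monicReduction_mul_aeval`), which is thus a retract of the free module `S[x]`, hence
flat. A Noetherian ring that is flat and integral over a polynomial ring is Cohen–Macaulay: regular
sequences generating the maximal ideals of the local rings of `S` stay regular, and heights do not
grow.

(a) ⇒ (b): Cohen–Macaulayness makes every associated prime minimal, and a minimal prime is generated
by exactly one vertex of each whisker, so its height is the number of whiskers.

(b) ⇒ (c): if `x_s → y_s` and `ω(x_s) > 1`, then `x_s` is not a source and an explicit monomial
outside the ideal is multiplied into it by both `x_s` and `y_s`. Some associated prime then contains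
both, and its height is too large.

(c) ⇒ (d): generators of the dual are minimal transversals of the supports of the polarized
generators. Over each `s`, list the variables of `x_s` before those of `y_s`. The polarized whisker
generator uses this whole fiber and every generator meets each fiber in an initial segment, so the
minimal transversals pick one variable per fiber, and moving a pick down gives another transversal.
Ordering by total rank yields linear quotients. -/

/-! ### Regularity of the local rings of a polynomial ring -/

section RegularParameters

open IsLocalRing RingTheory.Sequence

/-- The maximal ideal is generated by a regular sequence. -/
def HasRegularParameters (B : Type*) [CommRing B] [IsLocalRing B] : Prop :=
  ∃ rs : List B, IsRegular B rs ∧ Ideal.ofList rs = maximalIdeal B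

lemma HasRegularParameters.of_ringEquiv {B C : Type*} [CommRing B] [IsLocalRing B] [CommRing C]
    [IsLocalRing C] (e : B ≃+* C) (h : HasRegularParameters B) : HasRegularParameters C := by
  obtain ⟨rs, hr, hm⟩ := h
  refine ⟨rs.map e, ?_, ?_⟩
  · refine (AddEquiv.isRegular_congr (e := e.toAddEquiv) ?_).mp hr
    rw [List.forall₂_map_right_iff, List.forall₂_same]
    intro r _ x
    simp
  · have := Ideal.map_ofList (e : B →+* C) rs
    rw [hm] at this
    simpa using this.symm.trans (IsLocalRing.map_ringEquiv_maximalIdeal e)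

/-- The fiber over the closed point is a polynomial ring in one variable over the residue field, so
`p` is either the extended maximal ideal or needs one further monic generator, which is regular
modulo that prime ideal. -/
lemma Polynomial.hasRegularParameters_localization_of_comap_eq {B : Type*} [CommRing B]
    [IsLocalRing B] (h : HasRegularParameters B) (p : Ideal (Polynomial B)) [p.IsPrime]
    (hp : p.comap Polynomial.C = maximalIdeal B) :
    HasRegularParameters (Localization.AtPrime p) := by
  obtain ⟨rs, hr, hm⟩ := h
  have hle : (maximalIdeal B).map Polynomial.C ≤ p := by
    rw [← hp]; exact Ideal.map_comap_le
  have hw : IsWeaklyRegular (Polynomial B) (rs.map (algebraMap B (Polynomial B))) :=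
    hr.1.of_flat
  have hof : Ideal.ofList (rs.map (algebraMap B (Polynomial B))) =
      (maximalIdeal B).map Polynomial.C := by
    rw [← hm, Ideal.map_ofList]; rfl
  suffices ∃ ss : List (Polynomial B), IsWeaklyRegular (Polynomial B) ss ∧ Ideal.ofList ss = p by
    obtain ⟨ss, hs, hp'⟩ := this
    refine ⟨ss.map (algebraMap _ _), hs.isRegular_of_isLocalization_of_mem _ p ?_, ?_⟩
    · intro r hr
      rw [← hp']
      exact Ideal.subset_span hr
    · rw [← Ideal.map_ofList, hp', Localization.AtPrime.map_eq_maximalIdeal]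
  by_cases heq : p = (maximalIdeal B).map Polynomial.C
  · exact ⟨_, hw, hof.trans heq.symm⟩
  · have hmax : (p.comap Polynomial.C).IsMaximal := by rw [hp]; exact maximalIdeal.isMaximal B
    obtain ⟨y, -, hy⟩ := Polynomial.exists_monic_span_sup_map_eq B p hmax (by rwa [hp])
    rw [hp] at hy
    have hprime : ((maximalIdeal B).map Polynomial.C).IsPrime :=
      Ideal.isPrime_map_C_of_isPrime
    have hyn : y ∉ (maximalIdeal B).map Polynomial.C := by
      intro hy'
      apply heq
      rw [hy, sup_eq_left, Ideal.span_singleton_le_iff_mem]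
      exact hy'
    refine ⟨rs.map (algebraMap B (Polynomial B)) ++ [y], ?_, ?_⟩
    · rw [isWeaklyRegular_append_iff, isWeaklyRegular_singleton_iff]
      refine ⟨hw, ?_⟩
      rw [isSMulRegular_quotient_iff_mem_of_smul_mem]
      intro x hx
      rw [hof, smul_eq_mul, Ideal.mul_top] at hx ⊢
      exact (hprime.mem_or_mem hx).resolve_left hyn
    · rw [Ideal.ofList_append, Ideal.ofList_singleton, hof, ← hy]

/-- Localizing the coefficients at the contraction of `p` first reduces to a local base and a prime
lying over its maximal ideal. -/
lemma Polynomial.hasRegularParameters_localization {B : Type*} [CommRing B]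
    (h : ∀ (q : Ideal B) [q.IsPrime], HasRegularParameters (Localization.AtPrime q))
    (p : Ideal (Polynomial B)) [hpp : p.IsPrime] :
    HasRegularParameters (Localization.AtPrime p) := by
  let q := p.comap Polynomial.C
  let S := Polynomial (Localization.AtPrime q)
  let pc := Submonoid.map Polynomial.C.toMonoidHom q.primeCompl
  let : Algebra (Polynomial B) S := Polynomial.algebra B (Localization.AtPrime q)
  have : IsLocalization pc S := Polynomial.isLocalization _ _
  let pS := p.map (algebraMap (Polynomial B) S)
  have disj : Disjoint (pc : Set (Polynomial B)) (p : Set (Polynomial B)) := by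
    simpa [pc, q] using! Set.disjoint_image_left.mpr
      (Set.disjoint_compl_left_iff_subset.mpr (fun _ a ↦ a))
  have : pS.IsPrime := IsLocalization.isPrime_of_isPrime_disjoint pc _ _ ‹_› disj
  have : IsLocalization.AtPrime (Localization.AtPrime pS) p := by
    convert IsLocalization.isLocalization_isLocalization_atPrime_isLocalization pc
      (Localization.AtPrime pS) pS
    exact (IsLocalization.under_map_of_isPrime_disjoint pc _ ‹_› disj).symm
  have eq : Ideal.comap Polynomial.C pS = maximalIdeal (Localization.AtPrime q) := by
    rw [← IsLocalization.map_under q.primeCompl _ (Ideal.comap Polynomial.C pS),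
      ← IsLocalization.map_under q.primeCompl _ (maximalIdeal (Localization.AtPrime q))]
    simp only [Ideal.comap_comap, S, pS]
    rw [← Polynomial.algebraMap_eq (R := Localization.AtPrime q),
      ← IsScalarTower.algebraMap_eq B (Localization.AtPrime q)
        (Polynomial (Localization.AtPrime q)),
      IsScalarTower.algebraMap_eq B (Polynomial B) (Polynomial (Localization.AtPrime q)),
      ← Ideal.comap_comap, ← Ideal.under_def (Polynomial B),
      IsLocalization.under_map_of_isPrime_disjoint pc _ ‹_› disj]
    simp [q, IsLocalization.AtPrime.under_maximalIdeal (Localization.AtPrime q) q]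
  exact (Polynomial.hasRegularParameters_localization_of_comap_eq (h q) pS eq).of_ringEquiv
    (IsLocalization.algEquiv p.primeCompl
      (Localization.AtPrime pS) (Localization.AtPrime p)).toRingEquiv

lemma HasRegularParameters.localization_of_ringEquiv {B C : Type*} [CommRing B] [CommRing C]
    (e : B ≃+* C) (h : ∀ (q : Ideal B) [q.IsPrime], HasRegularParameters (Localization.AtPrime q))
    (p : Ideal C) [p.IsPrime] : HasRegularParameters (Localization.AtPrime p) :=
  (h (p.comap e)).of_ringEquiv <| IsLocalization.ringEquivOfRingEquiv
    (Localization.AtPrime (p.comap e)) (Localization.AtPrime p) e (e.map_primeCompl_comap_eq p)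

lemma Field.hasRegularParameters_localization {K : Type*} [Field K] (p : Ideal K) [p.IsPrime] :
    HasRegularParameters (Localization.AtPrime p) := by
  refine ⟨[], IsRegular.nil _ _, ?_⟩
  have hp : p = ⊥ := (Ideal.eq_bot_or_top p).resolve_right Ideal.IsPrime.ne_top'
  rw [← Localization.AtPrime.map_eq_maximalIdeal, Ideal.ofList_nil, eq_comm,
    Ideal.map_eq_bot_iff_le_ker]
  exact hp.le.trans bot_le

theorem MvPolynomial.hasRegularParameters_localization (K : Type*) [Field K] {ι : Type*}
    [Finite ι] (p : Ideal (MvPolynomial ι K)) [p.IsPrime] :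
    HasRegularParameters (Localization.AtPrime p) := by
  revert p
  induction ι using Finite.induction_empty_option with
  | of_equiv e H =>
    exact fun p hp => HasRegularParameters.localization_of_ringEquiv
      (renameEquiv K e).toRingEquiv (fun q _ => H q) p
  | h_empty =>
    exact fun p hp => HasRegularParameters.localization_of_ringEquiv
      (isEmptyRingEquiv K _).symm (fun q _ => Field.hasRegularParameters_localization q) p
  | h_option IH =>
    exact fun p hp => HasRegularParameters.localization_of_ringEquiv
      (MvPolynomial.optionEquivLeft K _).toRingEquiv.symm
      (fun q _ => Polynomial.hasRegularParameters_localization (fun q _ => IH q) q) p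

end RegularParameters

/-! ### Depth, and Cohen–Macaulayness by flat integral extension -/

section Depth

open IsLocalRing RingTheory.Sequence

lemma localRingDepth_le_ringKrullDim (A : Type*) [CommRing A] [IsLocalRing A]
    [IsNoetherianRing A] : (localRingDepth A : WithBot ℕ∞) ≤ ringKrullDim A := by
  rw [← IsLocalRing.maximalIdeal_height_eq_ringKrullDim]
  refine WithBot.coe_le_coe.mpr (iSup_le ?_)
  rintro ⟨rs, hmem, hrs⟩
  rw [← WithBot.coe_le_coe, IsLocalRing.maximalIdeal_height_eq_ringKrullDim,
    ← ringKrullDim_add_length_eq_ringKrullDim_of_isRegular rs hrs]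
  have hnt : Nontrivial (A ⧸ Ideal.ofList rs) := by
    refine Ideal.Quotient.nontrivial_iff.mpr fun h => hrs.2 ?_
    simp [h]
  have h0 : (0 : WithBot ℕ∞) ≤ ringKrullDim (A ⧸ Ideal.ofList rs) := ringKrullDim_nonneg_of_nontrivial
  calc ((rs.length : ℕ∞) : WithBot ℕ∞) = 0 + (rs.length : WithBot ℕ∞) := by simp
    _ ≤ _ := by gcongr

theorem isCohenMacaulayRing_of_flat_of_isIntegral {K V A : Type*} [Field K] [Finite V]
    [CommRing A] [IsNoetherianRing A] (φ : MvPolynomial V K →+* A) (hflat : φ.Flat)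
    (hint : φ.IsIntegral) : IsCohenMacaulayRing A := by
  refine ⟨inferInstance, fun P hP => le_antisymm (localRingDepth_le_ringKrullDim _) ?_⟩
  algebraize [φ]
  let q := P.under (MvPolynomial V K)
  have hqP : P.LiesOver q := ⟨rfl⟩
  obtain ⟨rs, hrs, hmax⟩ := MvPolynomial.hasRegularParameters_localization K q
  let := Localization.AtPrime.algebraOfLiesOver q P
  have : IsLocalHom (algebraMap (Localization.AtPrime q) (Localization.AtPrime P)) := by
    rw [RingHom.algebraMap_toAlgebra]
    exact Localization.isLocalHom_localRingHom q P (algebraMap _ A) Ideal.LiesOver.over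
  have : Module.FaithfullyFlat (Localization.AtPrime q) (Localization.AtPrime P) :=
    Module.FaithfullyFlat.of_flat_of_isLocalHom
  have hreg : RingTheory.Sequence.IsRegular (Localization.AtPrime P)
      (rs.map (algebraMap (Localization.AtPrime q) (Localization.AtPrime P))) :=
    hrs.of_faithfullyFlat
  have hmem : ∀ a ∈ rs.map (algebraMap (Localization.AtPrime q) (Localization.AtPrime P)),
      a ∈ maximalIdeal (Localization.AtPrime P) := by
    intro a ha
    obtain ⟨r, hr, rfl⟩ := List.mem_map.mp ha
    have : r ∈ maximalIdeal (Localization.AtPrime q) := hmax ▸ Ideal.subset_span hr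
    exact map_nonunit _ r this
  -- The fiber contribution to the height vanishes: by integrality `P` is minimal over the extension
  -- of `q`.
  have hh : P.height ≤ q.height := by
    refine (Ideal.height_le_height_add_of_liesOver q P).trans (le_of_eq ?_)
    have hmin := Ideal.IsIntegral.mem_minimalPrimes_map_under (R := MvPolynomial V K) P
    rw [Ideal.minimalPrimes_eq_comap] at hmin
    obtain ⟨P₀, hP₀, hP⟩ := hmin
    have : P₀.IsPrime := hP₀.1.1
    rw [← hP, Ideal.map_comap_of_surjective _ Ideal.Quotient.mk_surjective]
    rw [Ideal.height_eq_zero_iff.mpr hP₀, add_zero]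
  -- Modulo `rs` the local ring at `q` is a field, and each member of a regular sequence lowers the
  -- dimension by one.
  have hq : q.height ≤ rs.length := by
    rw [← WithBot.coe_le_coe, ← IsLocalization.AtPrime.ringKrullDim_eq_height q
      (Localization.AtPrime q), ← ringKrullDim_add_length_eq_ringKrullDim_of_isRegular rs hrs,
      ringKrullDim_eq_zero_of_isField, zero_add]
    · rfl
    · rw [hmax]
      exact (Ideal.Quotient.maximal_ideal_iff_isField_quotient _).mp (maximalIdeal.isMaximal _)
  rw [IsLocalization.AtPrime.ringKrullDim_eq_height P]
  refine WithBot.coe_le_coe.mpr ((hh.trans hq).trans ?_)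
  have := le_iSup (fun l : {l : List (Localization.AtPrime P) //
    (∀ a ∈ l, a ∈ maximalIdeal _) ∧ RingTheory.Sequence.IsRegular _ l} => (l.1.length : ℕ∞))
    ⟨_, hmem, hreg⟩
  simpa [localRingDepth] using this

theorem isCohenMacaulayRing_of_ringEquiv_quotient {K V R T : Type*} [Field K] [Finite V]
    [CommRing R] [IsNoetherianRing R] [CommRing T] [Algebra (MvPolynomial V K) T] (I : Ideal R)
    (Q : Ideal T) (hflat : Module.Flat (MvPolynomial V K) (T ⧸ Q))
    (hint : Algebra.IsIntegral (MvPolynomial V K) (T ⧸ Q)) (e : R ≃+* T)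
    (he : Q = I.map (e : R →+* T)) : IsCohenMacaulayRing (R ⧸ I) := by
  let e' := (Ideal.quotientEquiv I Q e he).symm
  exact isCohenMacaulayRing_of_flat_of_isIntegral
    (e'.toRingHom.comp (algebraMap (MvPolynomial V K) (T ⧸ Q)))
    (RingHom.Flat.comp (RingHom.flat_algebraMap_iff.mpr hflat)
      (RingHom.Flat.of_bijective e'.bijective))
    (RingHom.IsIntegral.trans _ _ (algebraMap_isIntegral_iff.mpr hint)
      (RingHom.isIntegral_of_surjective _ e'.surjective))

end Depth

/-! ### Flatness of quotients by monomials and monic univariate polynomials -/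

section MonicReduction

variable {S V : Type*} [CommRing S]

/-- The ideal generated by the monomials with exponent in `J` and by the univariate polynomials
`X t ^ w t * g t` in the variables `X t`. -/
noncomputable def monicMonomialIdeal (J : Set (V →₀ ℕ)) (w : V → ℕ) (g : V → Polynomial S) :
    Ideal (MvPolynomial V S) :=
  Ideal.span ((fun a => monomial a 1) '' J ∪
    Set.range fun t => Polynomial.aeval (X t) (Polynomial.X ^ w t * g t))

variable {J : Set (V →₀ ℕ)} {w : V → ℕ} {g : V → Polynomial S}

theorem isIntegral_quotient_monicMonomialIdeal (hg : ∀ t, (g t).Monic) :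
    Algebra.IsIntegral S (MvPolynomial V S ⧸ monicMonomialIdeal J w g) := by
  refine ⟨fun x => ?_⟩
  obtain ⟨p, rfl⟩ := Ideal.Quotient.mkₐ_surjective S _ x
  induction p using MvPolynomial.induction_on with
  | C a => exact isIntegral_algebraMap
  | add p q hp hq => rw [map_add]; exact hp.add hq
  | mul_X p t hp =>
    rw [map_mul]
    refine hp.mul ⟨Polynomial.X ^ w t * g t, (Polynomial.monic_X_pow _).mul (hg t), ?_⟩
    rw [← Polynomial.aeval_def, Polynomial.aeval_algHom_apply, Ideal.Quotient.mkₐ_eq_mk,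
      Ideal.Quotient.eq_zero_iff_mem]
    exact Ideal.subset_span (Or.inr ⟨t, rfl⟩)

variable [Fintype V]

open Classical in
/-- The `S`-linear map which sends the monomials with exponent in `J` to `0`, and reduces every
variable `X t` modulo `f t` in the other monomials. -/
noncomputable def monicReduction (J : Set (V →₀ ℕ)) (f : V → Polynomial S) :
    MvPolynomial V S →ₗ[S] MvPolynomial V S :=
  (basisMonomials V S).constr S fun a =>
    if a ∈ J then 0 else ∏ t, Polynomial.aeval (X t) (Polynomial.X ^ a t %ₘ f t)

open Classical in
lemma monicReduction_monomial (J : Set (V →₀ ℕ)) (f : V → Polynomial S) (a : V →₀ ℕ) :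
    monicReduction J f (monomial a 1) =
      if a ∈ J then 0 else ∏ t, Polynomial.aeval (X t) (Polynomial.X ^ a t %ₘ f t) := by
  have := (basisMonomials V S).constr_basis S (fun a =>
    if a ∈ J then (0 : MvPolynomial V S) else
      ∏ t, Polynomial.aeval (X t) (Polynomial.X ^ a t %ₘ f t)) a
  rwa [coe_basisMonomials] at this

lemma monicReduction_monomial_mul_monomial (hJ : IsUpperSet J) (f : V → Polynomial S) {a : V →₀ ℕ}
    (ha : a ∈ J) (p : MvPolynomial V S) :
    monicReduction J f (p * monomial a 1) = 0 := by
  induction p using MvPolynomial.induction_on' with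
  | add p q hp hq => rw [add_mul, map_add, hp, hq, add_zero]
  | monomial b c =>
    have : monomial b c * monomial a (1 : S) = c • monomial (b + a) 1 := by
      simp [monomial_mul, smul_monomial]
    rw [this, map_smul, monicReduction_monomial, if_pos (hJ le_add_self ha), smul_zero]

/-- By `hJw`, membership in `J` does not depend on the exponent of `X t` beyond `w t`. Hence for a
monomial times `X t ^ w t * g t` there are two cases: all terms lie in `J`, or none does and the
reduction is division with remainder in `X t` alone. -/
lemma monicReduction_mul_aeval (hJ : IsUpperSet J)
    (hJw : ∀ a t k, a + Finsupp.single t (w t + k) ∈ J → a + Finsupp.single t (w t) ∈ J)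
    (hg : ∀ t, (g t).Monic) (t : V) (p : MvPolynomial V S) :
    monicReduction J (fun t => Polynomial.X ^ w t * g t)
      (p * Polynomial.aeval (X t) (Polynomial.X ^ w t * g t)) = 0 := by
  classical
  set f : V → Polynomial S := fun t => Polynomial.X ^ w t * g t
  have hf : ∀ t, (f t).Monic := fun t => (Polynomial.monic_X_pow _).mul (hg t)
  induction p using MvPolynomial.induction_on' with
  | add p q hp hq => rw [add_mul, map_add, hp, hq, add_zero]
  | monomial a c =>
    have hc : monomial a c = c • monomial a (1 : S) := by simp [smul_monomial]
    rw [hc, smul_mul_assoc, map_smul]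
    convert smul_zero c
    by_cases ha : a + Finsupp.single t (w t) ∈ J
    · have : monomial a (1 : S) * Polynomial.aeval (X t) (Polynomial.X ^ w t * g t) =
          Polynomial.aeval (X t) (g t) * monomial (a + Finsupp.single t (w t)) 1 := by
        rw [map_mul, map_pow, Polynomial.aeval_X, X_pow_eq_monomial, ← mul_assoc, monomial_mul,
          one_mul, mul_comm]
      rw [this, monicReduction_monomial_mul_monomial hJ _ ha]
    · have hn : ∀ k, a + Finsupp.single t k ∉ J := by
        intro k hk
        rcases le_total k (w t) with h | h
        · exact ha (hJ (by gcongr) hk)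
        · obtain ⟨l, rfl⟩ := Nat.exists_eq_add_of_le h
          exact ha (hJw a t l hk)
      -- With no power of `X t` leading into `J`, multiplication by a polynomial in `X t` changes
      -- only the factor at `t`.
      have key : ∀ h : Polynomial S,
          monicReduction J f (monomial a 1 * Polynomial.aeval (X t) h) =
            (∏ s ∈ Finset.univ.erase t, Polynomial.aeval (X s) (Polynomial.X ^ a s %ₘ f s)) *
              Polynomial.aeval (X t) ((Polynomial.X ^ a t * h) %ₘ f t) := by
        intro h
        induction h using Polynomial.induction_on' with
        | add p q hp hq =>
          rw [map_add, mul_add, map_add, hp, hq, mul_add, Polynomial.add_modByMonic, map_add,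
            mul_add]
        | monomial k c =>
          have h1 : monomial a 1 * Polynomial.aeval (X t) (Polynomial.monomial k c) =
              c • monomial (a + Finsupp.single t k) (1 : S) := by
            rw [← Polynomial.C_mul_X_pow_eq_monomial, map_mul, map_pow, Polynomial.aeval_X,
              Polynomial.aeval_C, X_pow_eq_monomial, ← Algebra.smul_def, mul_smul_comm,
              monomial_mul, one_mul]
          have h2 : Polynomial.X ^ a t * Polynomial.monomial k c =
              c • (Polynomial.X ^ (a t + k) : Polynomial S) := by
            rw [← Polynomial.C_mul_X_pow_eq_monomial, Polynomial.smul_eq_C_mul]; ring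
          rw [h1, map_smul, monicReduction_monomial, if_neg (hn k), h2, Polynomial.smul_modByMonic,
            map_smul, mul_smul_comm, ← Finset.mul_prod_erase _ _ (Finset.mem_univ t), mul_comm]
          congr 2
          · refine Finset.prod_congr rfl fun s hs => ?_
            simp [(Finset.ne_of_mem_erase hs).symm]
          · simp
      rw [key, (Polynomial.modByMonic_eq_zero_iff_dvd (hf t)).mpr (dvd_mul_left _ _), map_zero,
        mul_zero]

lemma monicReduction_eq_zero_of_mem (hJ : IsUpperSet J)
    (hJw : ∀ a t k, a + Finsupp.single t (w t + k) ∈ J → a + Finsupp.single t (w t) ∈ J)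
    (hg : ∀ t, (g t).Monic) {q : MvPolynomial V S} (hq : q ∈ monicMonomialIdeal J w g) :
    monicReduction J (fun t => Polynomial.X ^ w t * g t) q = 0 := by
  suffices ∀ p, monicReduction J (fun t => Polynomial.X ^ w t * g t) (p * q) = 0 by
    simpa using this 1
  induction hq using Submodule.span_induction with
  | mem x hx =>
    rcases hx with ⟨a, ha, rfl⟩ | ⟨t, rfl⟩
    · exact monicReduction_monomial_mul_monomial hJ _ ha
    · exact monicReduction_mul_aeval hJ hJw hg t
  | zero => simp
  | add x y _ _ hx hy => intro p; rw [mul_add, map_add, hx, hy, add_zero]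
  | smul r x _ hx => intro p; rw [smul_eq_mul, ← mul_assoc]; exact hx _

/-- Reduction changes a polynomial only by elements of the ideal, so it is a section of the quotient
map once it descends. -/
lemma mk_monicReduction (hg : ∀ t, (g t).Monic) (p : MvPolynomial V S) :
    Ideal.Quotient.mk (monicMonomialIdeal J w g)
      (monicReduction J (fun t => Polynomial.X ^ w t * g t) p) =
    Ideal.Quotient.mk (monicMonomialIdeal J w g) p := by
  classical
  have hf : ∀ t, (Polynomial.X ^ w t * g t).Monic := fun t => (Polynomial.monic_X_pow _).mul (hg t)
  induction p using MvPolynomial.induction_on' with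
  | add p q hp hq => rw [map_add, map_add, map_add, hp, hq]
  | monomial a c =>
    have hc : monomial a c = C c * monomial a (1 : S) := by simp [C_mul_monomial]
    rw [hc, ← smul_eq_C_mul, map_smul, smul_eq_C_mul, smul_eq_C_mul, map_mul, map_mul,
      monicReduction_monomial]
    congr 1
    split_ifs with ha
    · rw [map_zero, eq_comm, Ideal.Quotient.eq_zero_iff_mem]
      exact Ideal.subset_span (Or.inl ⟨a, ha, rfl⟩)
    · have hm : monomial a (1 : S) = ∏ t, X t ^ a t := by
        rw [monomial_eq, C_1, one_mul, Finsupp.prod_fintype _ _ (by simp)]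
      rw [hm, map_prod, map_prod]
      refine Finset.prod_congr rfl fun t _ => ?_
      have h1 := congrArg (Polynomial.aeval (X t : MvPolynomial V S))
        (Polynomial.modByMonic_add_div (Polynomial.X ^ a t) (Polynomial.X ^ w t * g t))
      rw [map_add, map_pow, Polynomial.aeval_X] at h1
      rw [← h1, map_add, eq_comm, add_eq_left, Ideal.Quotient.eq_zero_iff_mem, map_mul]
      exact Ideal.mul_mem_right _ _ (Ideal.subset_span (Or.inr ⟨t, rfl⟩))

theorem flat_quotient_monicMonomialIdeal (hJ : IsUpperSet J)
    (hJw : ∀ a t k, a + Finsupp.single t (w t + k) ∈ J → a + Finsupp.single t (w t) ∈ J)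
    (hg : ∀ t, (g t).Monic) :
    Module.Flat S (MvPolynomial V S ⧸ monicMonomialIdeal J w g) := by
  let N := monicReduction J (fun t => Polynomial.X ^ w t * g t)
  let i : (MvPolynomial V S ⧸ monicMonomialIdeal J w g) →ₗ[S] MvPolynomial V S :=
    Submodule.liftQ ((monicMonomialIdeal J w g).restrictScalars S) N fun q hq =>
      monicReduction_eq_zero_of_mem hJ hJw hg hq
  refine Module.Flat.of_retract i (Ideal.Quotient.mkₐ S _).toLinearMap ?_
  refine LinearMap.ext fun x => ?_
  obtain ⟨p, rfl⟩ := Ideal.Quotient.mk_surjective x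
  exact mk_monicReduction hg p

end MonicReduction

/-! ### Edge ideals of whiskered graphs, and (c) ⇒ (a) -/

namespace WeightedOrientedGraph

section EdgeIdeal

variable {W : Type*} (D : WeightedOrientedGraph W) (K : Type*) [Field K]

/-- The exponent vector of the generator of the edge ideal belonging to the edge `(u, v)`. -/
noncomputable def edgeExponent (u v : W) : W →₀ ℕ :=
  Finsupp.single u 1 + Finsupp.single v (D.weight v)

lemma monomial_edgeExponent (u v : W) :
    monomial (D.edgeExponent u v) (1 : K) = X u * X v ^ D.weight v := by
  rw [X_pow_eq_monomial, X, monomial_mul, one_mul, edgeExponent]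

lemma edgeIdeal_eq_span_monomial : D.edgeIdeal K =
    Ideal.span ((fun a => monomial a (1 : K)) '' {a | ∃ u v, D.Adj u v ∧ a = D.edgeExponent u v}) := by
  rw [edgeIdeal]
  congr 1
  ext f
  constructor
  · rintro ⟨u, v, h, rfl⟩
    exact ⟨_, ⟨u, v, h, rfl⟩, D.monomial_edgeExponent K u v⟩
  · rintro ⟨_, ⟨u, v, h, rfl⟩, rfl⟩
    exact ⟨u, v, h, D.monomial_edgeExponent K u v⟩

lemma monomial_mem_edgeIdeal {b : W →₀ ℕ} :
    monomial b (1 : K) ∈ D.edgeIdeal K ↔ ∃ u v, D.Adj u v ∧ D.edgeExponent u v ≤ b := by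
  classical
  rw [edgeIdeal_eq_span_monomial, mem_ideal_span_monomial_image]
  simp only [support_monomial, one_ne_zero, if_false, Finset.mem_singleton, forall_eq]
  constructor
  · rintro ⟨_, ⟨u, v, h, rfl⟩, hb⟩
    exact ⟨u, v, h, hb⟩
  · rintro ⟨u, v, h, hb⟩
    exact ⟨_, ⟨u, v, h, rfl⟩, hb⟩

variable {D} in
lemma Adj.mul_mem_edgeIdeal {u v : W} (h : D.Adj u v) :
    X u * X v ^ D.weight v ∈ D.edgeIdeal K :=
  Ideal.subset_span ⟨u, v, h, rfl⟩

end EdgeIdeal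

section Whisker

variable {V : Type*}

/-- The underlying graph arises from a graph on `V` by attaching the whisker from `inl s` to `inr s`
for every `s`. -/
structure IsWhiskered (D : WeightedOrientedGraph (V ⊕ V)) : Prop where
  whisker : ∀ s, D.Adj (.inl s) (.inr s) ∨ D.Adj (.inr s) (.inl s)
  eq_of_adj_inl_inr : ∀ s t, D.Adj (.inl s) (.inr t) → s = t
  eq_of_adj_inr_inl : ∀ s t, D.Adj (.inr s) (.inl t) → s = t
  not_adj_inr_inr : ∀ s t, ¬ D.Adj (.inr s) (.inr t)

variable {D : WeightedOrientedGraph (V ⊕ V)}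

lemma isWhiskered_of_underlyingGraph_eq {G' : SimpleGraph V}
    (hG : D.underlyingGraph = G'.whiskerGraph) : D.IsWhiskered := by
  have h : ∀ u v, (u ≠ v ∧ (D.Adj u v ∨ D.Adj v u)) ↔ G'.whiskerGraph.Adj u v := by
    intro u v
    rw [← hG]
    rfl
  simp only [SimpleGraph.whiskerGraph, SimpleGraph.fromRel_adj] at h
  refine ⟨fun s => ?_, fun s t hst => ?_, fun s t hst => ?_, fun s t hst => ?_⟩
  · have := (h (.inl s) (.inr s)).mpr (by simp)
    exact this.2
  · have := (h (.inl s) (.inr t)).mp (by simp [hst])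
    simpa [eq_comm] using this
  · have := (h (.inr s) (.inl t)).mp (by simp [hst])
    simpa [eq_comm] using this
  · have := (h (.inr s) (.inr t)).mp ⟨fun h => D.loopless _ (h ▸ hst), Or.inl hst⟩
    simp at this

lemma IsWhiskered.exists_adj (hD : D.IsWhiskered) (v : V ⊕ V) :
    ∃ u, D.Adj u v ∨ D.Adj v u := by
  rcases v with s | s
  · exact ⟨.inr s, (hD.whisker s).symm⟩
  · exact ⟨.inl s, hD.whisker s⟩

lemma IsWhiskered.weight_inr_eq_one (hD : D.IsWhiskered)
    (hsource : ∀ v, D.IsSource v → D.weight v = 1) {s t : V} (h : D.Adj (.inr s) (.inl t)) :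
    D.weight (.inr s) = 1 := by
  refine hsource _ ⟨⟨_, h⟩, ?_⟩
  rintro (u | u) hu
  · obtain rfl := hD.eq_of_adj_inl_inr _ _ hu
    obtain rfl := hD.eq_of_adj_inr_inl _ _ h
    exact D.asymm _ _ hu h
  · exact hD.not_adj_inr_inr _ _ hu

lemma exists_adj_of_weight_ne_one {W : Type*} {D : WeightedOrientedGraph W}
    (hsource : ∀ v, D.IsSource v → D.weight v = 1) {u v : W} (h : D.Adj v u)
    (hw : D.weight v ≠ 1) : ∃ t, D.Adj t v := by
  by_contra! hn
  exact hw (hsource v ⟨⟨u, h⟩, hn⟩)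

section Artinian

variable (D)

/-- The exponent vectors divisible by a generator belonging to an edge between the `inl s`. -/
def innerExponents : Set (V →₀ ℕ) :=
  {a | ∃ s t, D.Adj (.inl s) (.inl t) ∧
    Finsupp.single s 1 + Finsupp.single t (D.weight (.inl t)) ≤ a}

lemma isUpperSet_innerExponents : IsUpperSet D.innerExponents := by
  rintro a b hab ⟨s, t, hst, h⟩
  exact ⟨s, t, hst, h.trans hab⟩

/-- An inner generator has exponent 0, 1 or `ω(x_t)` at `x_t`, never more than `ω(x_t)`, so excess
there is irrelevant. This is the hypothesis `hJw` of the flatness criterion. -/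
lemma add_single_mem_innerExponents (a : V →₀ ℕ) (t : V) (k : ℕ)
    (h : a + Finsupp.single t (D.weight (.inl t) + k) ∈ D.innerExponents) :
    a + Finsupp.single t (D.weight (.inl t)) ∈ D.innerExponents := by
  classical
  obtain ⟨s, u, hsu, h⟩ := h
  refine ⟨s, u, hsu, fun i => ?_⟩
  have hne : s ≠ u := by
    rintro rfl
    exact D.loopless _ hsu
  have hi := h i
  have := D.weight_pos (.inl t)
  simp only [Finsupp.add_apply, Finsupp.single_apply] at hi ⊢
  split_ifs at hi ⊢ <;> subst_vars <;> first | omega | contradiction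

/-- The substitution `y t ↦ x t + θ t`, where the coefficients of the target are the polynomials
in the `θ t`. -/
noncomputable def shiftEquiv (V K : Type*) [Field K] :
    MvPolynomial (V ⊕ V) K ≃+* MvPolynomial V (MvPolynomial V K) :=
  RingEquiv.ofRingHom
    (eval₂Hom (C.comp C) (Sum.elim X fun t => X t + C (X t)))
    (eval₂Hom (eval₂Hom C fun t => X (.inr t) - X (.inl t)) fun t => X (.inl t))
    (by
      refine ringHom_ext (fun p => ?_) (by simp)
      induction p using MvPolynomial.induction_on with
      | C a => simp
      | add p q hp hq => simp_all
      | mul_X p t hp => simp_all)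
    (by
      refine ringHom_ext (by simp) ?_
      rintro (t | t) <;> simp)

variable {K : Type*} [Field K]

lemma monicMonomialIdeal_eq_map_edgeIdeal {S : Type*} [CommRing S]
    (e : MvPolynomial (V ⊕ V) K →+* MvPolynomial V S) (θ : V → S)
    (hl : ∀ t, e (X (.inl t)) = X t) (hr : ∀ t, e (X (.inr t)) = X t + C (θ t))
    (hD : D.IsWhiskered)
    (hsource : ∀ v, D.IsSource v → D.weight v = 1)
    (hw : ∀ s : V, D.Adj (.inl s) (.inr s) → D.weight (.inl s) = 1) :
    monicMonomialIdeal D.innerExponents (fun t => D.weight (.inl t))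
      (fun t => (Polynomial.X + Polynomial.C (θ t)) ^ D.weight (.inr t)) =
    (D.edgeIdeal K).map e := by
  have hmem : ∀ f ∈ D.edgeIdeal K, e f ∈ (D.edgeIdeal K).map e :=
    fun f hf => Ideal.mem_map_of_mem e hf
  have hwhisker : ∀ t, Polynomial.aeval (X t : MvPolynomial V S)
      (Polynomial.X ^ D.weight (.inl t) *
        (Polynomial.X + Polynomial.C (θ t)) ^ D.weight (.inr t)) =
      e (X (.inl t) ^ D.weight (.inl t) * X (.inr t) ^ D.weight (.inr t)) := by
    intro t
    simp [hl, hr, algebraMap_eq]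
  -- The tail of the whisker has weight 1 in both orientations, by `hw` or because a leaf with an
  -- outgoing edge is a source.
  have hgen : ∀ t, X (.inl t) ^ D.weight (.inl t) * X (.inr t) ^ D.weight (.inr t) ∈
      D.edgeIdeal K := by
    intro t
    rcases hD.whisker t with h | h
    · rw [hw t h, pow_one]
      exact Adj.mul_mem_edgeIdeal K h
    · rw [hD.weight_inr_eq_one hsource h, pow_one, mul_comm]
      exact Adj.mul_mem_edgeIdeal K h
  have hedge : ∀ s t, monomial (Finsupp.single s 1 + Finsupp.single t (D.weight (.inl t))) 1 =
      e (X (.inl s) * X (.inl t) ^ D.weight (.inl t)) := by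
    intro s t
    rw [map_mul, map_pow, hl, hl, X_pow_eq_monomial, X, monomial_mul, one_mul]
  apply le_antisymm
  · rw [monicMonomialIdeal, Ideal.span_le]
    rintro _ (⟨a, ⟨s, t, hst, ha⟩, rfl⟩ | ⟨t, rfl⟩)
    · obtain ⟨b, rfl⟩ := exists_add_of_le ha
      have : monomial (Finsupp.single s 1 + Finsupp.single t (D.weight (.inl t)) + b)
          (1 : S) = monomial b 1 *
            e (X (.inl s) * X (.inl t) ^ D.weight (.inl t)) := by
        rw [← hedge, monomial_mul, one_mul, add_comm]
      rw [SetLike.mem_coe]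
      beta_reduce
      rw [this]
      exact Ideal.mul_mem_left _ _ (hmem _ (Adj.mul_mem_edgeIdeal K hst))
    · rw [SetLike.mem_coe]
      beta_reduce
      rw [hwhisker]
      exact hmem _ (hgen t)
  · rw [edgeIdeal, Ideal.map_span, Ideal.span_le]
    have hgen' : ∀ t, e
        (X (.inl t) ^ D.weight (.inl t) * X (.inr t) ^ D.weight (.inr t)) ∈
        monicMonomialIdeal D.innerExponents (fun t => D.weight (.inl t))
      (fun t => (Polynomial.X + Polynomial.C (θ t)) ^ D.weight (.inr t)) := by
      intro t
      rw [← hwhisker]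
      exact Ideal.subset_span (Or.inr ⟨t, rfl⟩)
    rintro _ ⟨_, ⟨s | s, t | t, hst, rfl⟩, rfl⟩
    · exact Ideal.subset_span (Or.inl ⟨_, ⟨s, t, hst, le_rfl⟩, hedge s t⟩)
    · obtain rfl := hD.eq_of_adj_inl_inr _ _ hst
      have := hgen' s
      rwa [hw s hst, pow_one] at this
    · obtain rfl := hD.eq_of_adj_inr_inl _ _ hst
      have := hgen' s
      rwa [hD.weight_inr_eq_one hsource hst, pow_one, mul_comm] at this
    · exact (hD.not_adj_inr_inr _ _ hst).elim

theorem isCohenMacaulay_of_weight_eq_one [Finite V] (hD : D.IsWhiskered)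
    (hsource : ∀ v, D.IsSource v → D.weight v = 1)
    (hw : ∀ s : V, D.Adj (.inl s) (.inr s) → D.weight (.inl s) = 1) : D.IsCohenMacaulay K := by
  have := Fintype.ofFinite V
  let e₀ : MvPolynomial (V ⊕ V) K →+* MvPolynomial V (MvPolynomial V K) :=
    (shiftEquiv V K).toRingHom
  have hI := D.monicMonomialIdeal_eq_map_edgeIdeal e₀ X
      (fun t => by simp [e₀, shiftEquiv]) (fun t => by simp [e₀, shiftEquiv]) hD hsource hw
  have hg : ∀ t, ((Polynomial.X + Polynomial.C (X t : MvPolynomial V K)) ^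
      D.weight (.inr t)).Monic := fun t => (Polynomial.monic_X_add_C _).pow _
  have hflat := flat_quotient_monicMonomialIdeal D.isUpperSet_innerExponents
    D.add_single_mem_innerExponents hg
  have hint := isIntegral_quotient_monicMonomialIdeal (J := D.innerExponents)
    (w := fun t => D.weight (.inl t)) hg
  exact isCohenMacaulayRing_of_ringEquiv_quotient (D.edgeIdeal K) _ hflat hint
    (shiftEquiv V K) hI

end Artinian

end Whisker

end WeightedOrientedGraph

/-! ### Primes generated by variables and their heights -/

section VariableIdeals

variable {σ K : Type*} [Field K]

theorem MvPolynomial.isPrime_span_X_image (C : Set σ) :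
    (Ideal.span (X '' C : Set (MvPolynomial σ K))).IsPrime := by
  classical
  -- Setting the variables in `C` to zero has the ideal as kernel and a domain as target.
  let φ : MvPolynomial σ K →ₐ[K] MvPolynomial σ K := aeval fun v => if v ∈ C then 0 else X v
  have hφ : ∀ p, p - φ p ∈ Ideal.span (X '' C : Set (MvPolynomial σ K)) := by
    intro p
    induction p using MvPolynomial.induction_on with
    | C a => simp [φ]
    | add p q hp hq =>
      rw [map_add, add_sub_add_comm]
      exact add_mem hp hq
    | mul_X p v hp =>
      have : p * X v - φ (p * X v) = (p - φ p) * X v + φ p * (X v - φ (X v)) := by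
        rw [map_mul]; ring
      rw [this]
      refine add_mem (Ideal.mul_mem_right _ _ hp) (Ideal.mul_mem_left _ _ ?_)
      by_cases hv : v ∈ C
      · simpa [φ, hv] using Ideal.subset_span (Set.mem_image_of_mem X hv)
      · simp [φ, hv]
  have : Ideal.span (X '' C : Set (MvPolynomial σ K)) = RingHom.ker φ := by
    apply le_antisymm
    · rw [Ideal.span_le]
      rintro _ ⟨v, hv, rfl⟩
      simp [φ, hv, RingHom.mem_ker]
    · intro p hp
      have := hφ p
      rwa [(RingHom.mem_ker).mp hp, sub_zero] at this
  rw [this]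
  exact RingHom.ker_isPrime φ

theorem MvPolynomial.X_mem_span_X_image {C : Set σ} {v : σ} :
    (X v : MvPolynomial σ K) ∈ Ideal.span (X '' C : Set (MvPolynomial σ K)) ↔ v ∈ C := by
  classical
  refine ⟨fun h => ?_, fun h => Ideal.subset_span ⟨v, h, rfl⟩⟩
  obtain ⟨i, hi, hv⟩ := mem_ideal_span_X_image.mp h (Finsupp.single v 1) (by simp [X])
  rw [Finsupp.single_apply_ne_zero] at hv
  rwa [← hv.1]

theorem MvPolynomial.card_le_height_span_X_image (F : Finset σ) :
    (F.card : ℕ∞) ≤ (Ideal.span (X '' (F : Set σ) : Set (MvPolynomial σ K))).height := by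
  classical
  induction F using Finset.induction_on with
  | empty => simp
  | insert v F hv ih =>
    have h1 := isPrime_span_X_image (K := K) (F : Set σ)
    have h2 := isPrime_span_X_image (K := K) ((insert v F : Finset σ) : Set σ)
    have hlt : Ideal.span (X '' (F : Set σ) : Set (MvPolynomial σ K)) <
        Ideal.span (X '' ((insert v F : Finset σ) : Set σ)) := by
      refine lt_of_le_of_ne (Ideal.span_mono (Set.image_mono (by simp))) fun h => hv ?_
      have : (X v : MvPolynomial σ K) ∈ Ideal.span (X '' ((insert v F : Finset σ) : Set σ)) :=
        X_mem_span_X_image.mpr (by simp)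
      rw [← h, X_mem_span_X_image] at this
      exact_mod_cast this
    rw [Finset.card_insert_of_notMem hv, Nat.cast_add, Nat.cast_one]
    exact (add_le_add_left ih 1).trans (Ideal.height_add_one_le_of_lt_of_isPrime hlt)

theorem MvPolynomial.card_le_height (P : Ideal (MvPolynomial σ K)) (F : Finset σ)
    (h : ∀ v ∈ F, X v ∈ P) : (F.card : ℕ∞) ≤ P.height := by
  refine (card_le_height_span_X_image (K := K) F).trans (Ideal.height_mono ?_)
  rw [Ideal.span_le]
  rintro _ ⟨v, hv, rfl⟩
  exact h v hv

theorem MvPolynomial.height_span_X_image_le [Finite σ] (F : Finset σ) :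
    (Ideal.span (X '' (F : Set σ) : Set (MvPolynomial σ K))).height ≤ F.card := by
  classical
  have := isPrime_span_X_image (K := K) (F : Set σ)
  have h := Ideal.height_le_card_of_mem_minimalPrimes_span_finset (s := F.image X)
    (p := Ideal.span (X '' (F : Set σ) : Set (MvPolynomial σ K)))
    (by rw [Finset.coe_image, Ideal.minimalPrimes_eq_subsingleton_self]; rfl)
  exact h.trans (by exact_mod_cast Finset.card_image_le)

end VariableIdeals

/-! ### Associated primes and unmixedness -/

/-- After localizing at an associated prime, the maximal ideal kills a nonzero element, so the depth
is 0. Cohen–Macaulayness then forces dimension 0. -/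
theorem IsCohenMacaulayRing.mem_minimalPrimes {R : Type*} [CommRing R] [IsNoetherianRing R]
    {I P : Ideal R} (h : IsCohenMacaulayRing (R ⧸ I)) (hP : P ∈ associatedPrimes R (R ⧸ I)) :
    P ∈ I.minimalPrimes := by
  obtain ⟨hprime, z, hz⟩ := isAssociatedPrime_iff.mp hP
  have hann : ∀ a, a ∈ P ↔ Ideal.Quotient.mk I a * z = 0 := by
    intro a
    rw [hz, Submodule.mem_colon_singleton, Submodule.mem_bot, Algebra.smul_def]
    rfl
  have hIP : I ≤ P := fun a ha => by
    rw [hann, Ideal.Quotient.eq_zero_iff_mem.mpr ha, zero_mul]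
  let P' := P.map (Ideal.Quotient.mk I)
  have hcomap : P'.comap (Ideal.Quotient.mk I) = P := by
    rw [Ideal.comap_map_of_surjective' _ Ideal.Quotient.mk_surjective, Ideal.mk_ker,
      sup_eq_left.mpr hIP]
  have hP' : P'.IsPrime := Ideal.map_isPrime_of_surjective Ideal.Quotient.mk_surjective
    (by rwa [Ideal.mk_ker])
  let A := Localization.AtPrime P'
  have hann' : ∀ a, a ∈ P' ↔ a * z = 0 := by
    intro a
    obtain ⟨a, rfl⟩ := Ideal.Quotient.mk_surjective a
    rw [← hann, ← Ideal.mem_comap, hcomap]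
  have hz0 : algebraMap (R ⧸ I) A z ≠ 0 := by
    rw [Ne, IsLocalization.map_eq_zero_iff P'.primeCompl]
    rintro ⟨⟨m, hm⟩, hmz⟩
    exact hm ((hann' m).mpr hmz)
  have hkill : ∀ a ∈ IsLocalRing.maximalIdeal A, a * algebraMap (R ⧸ I) A z = 0 := by
    intro a ha
    rw [← Localization.AtPrime.map_eq_maximalIdeal] at ha
    refine Submodule.span_induction (p := fun a _ => a * algebraMap (R ⧸ I) A z = 0)
      ?_ (zero_mul _) ?_ ?_ ha
    · rintro _ ⟨a, ha, rfl⟩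
      rw [← map_mul, (hann' a).mp ha, map_zero]
    · intro x y _ _ hx hy
      rw [add_mul, hx, hy, add_zero]
    · intro r x _ hx
      rw [smul_eq_mul, mul_assoc, hx, mul_zero]
  have hdepth : localRingDepth A = 0 := by
    rw [localRingDepth, ENat.iSup_eq_zero]
    rintro ⟨rs, hmem, hrs⟩
    rcases rs with _ | ⟨a, rs⟩
    · rfl
    · have := ((RingTheory.Sequence.isRegular_cons_iff _ _ _).mp hrs).1
      exact (hz0 (this (by
        simpa using hkill a (hmem a (by simp))))).elim
  have hdim := h.2 P'
  rw [hdepth, IsLocalization.AtPrime.ringKrullDim_eq_height P'] at hdim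
  have hheight : P'.height = 0 := (WithBot.coe_injective hdim).symm
  rw [Ideal.minimalPrimes_eq_comap]
  exact ⟨P', Ideal.height_eq_zero_iff.mp hheight, hcomap⟩

namespace WeightedOrientedGraph

section Unmixed

variable {V : Type*} {D : WeightedOrientedGraph (V ⊕ V)} {K : Type*} [Field K]

/-- A prime containing the edge ideal contains a vertex of every edge. -/
lemma mem_or_mem_of_adj {W : Type*} {D : WeightedOrientedGraph W}
    {P : Ideal (MvPolynomial W K)} [hP : P.IsPrime] (hI : D.edgeIdeal K ≤ P) {u v : W}
    (h : D.Adj u v) : X u ∈ P ∨ X v ∈ P :=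
  (hP.mem_or_mem (hI (Adj.mul_mem_edgeIdeal K h))).imp_right (hP.mem_of_pow_mem _)

lemma IsWhiskered.mem_or_mem (hD : D.IsWhiskered) {P : Ideal (MvPolynomial (V ⊕ V) K)}
    [hP : P.IsPrime] (hI : D.edgeIdeal K ≤ P) (s : V) : X (.inl s) ∈ P ∨ X (.inr s) ∈ P := by
  rcases hD.whisker s with h | h
  · exact mem_or_mem_of_adj hI h
  · exact (mem_or_mem_of_adj hI h).symm

lemma edgeIdeal_le_span_X_image {W : Type*} {D : WeightedOrientedGraph W} {C : Set W}
    (h : ∀ u v, D.Adj u v → u ∈ C ∨ v ∈ C) :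
    D.edgeIdeal K ≤ Ideal.span (X '' C : Set (MvPolynomial W K)) := by
  rw [edgeIdeal, Ideal.span_le]
  rintro _ ⟨u, v, huv, rfl⟩
  rcases h u v huv with hu | hv
  · exact Ideal.mul_mem_right _ _ (Ideal.subset_span ⟨u, hu, rfl⟩)
  · refine Ideal.mul_mem_left _ _ (Ideal.pow_mem_of_mem _ (Ideal.subset_span (Set.mem_image_of_mem X hv)) _ ?_)
    exact D.weight_pos v

lemma eq_span_X_of_mem_minimalPrimes {W : Type*} {D : WeightedOrientedGraph W}
    {P : Ideal (MvPolynomial W K)} (hP : P ∈ (D.edgeIdeal K).minimalPrimes) {C : Set W}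
    (hCP : ∀ v ∈ C, X v ∈ P) (hC : ∀ u v, D.Adj u v → u ∈ C ∨ v ∈ C) :
    P = Ideal.span (X '' C) := by
  have hle : Ideal.span (X '' C) ≤ P := by
    rw [Ideal.span_le]
    rintro _ ⟨v, hv, rfl⟩
    exact hCP v hv
  exact le_antisymm (hP.2 ⟨isPrime_span_X_image C, edgeIdeal_le_span_X_image hC⟩ hle) hle

/-- The only neighbor of `y_s` is `x_s`, so a vertex cover containing `x_s` remains a cover without
`y_s`, contradicting minimality. -/
lemma IsWhiskered.not_mem_and_mem (hD : D.IsWhiskered) {P : Ideal (MvPolynomial (V ⊕ V) K)}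
    (hP : P ∈ (D.edgeIdeal K).minimalPrimes) (s : V) : ¬ (X (.inl s) ∈ P ∧ X (.inr s) ∈ P) := by
  rintro ⟨hx, hy⟩
  have := hP.1.1
  let C : Set (V ⊕ V) := {v | X v ∈ P ∧ v ≠ .inr s}
  have hPC : P = Ideal.span (X '' C) := by
    refine eq_span_X_of_mem_minimalPrimes hP (fun v hv => hv.1) fun u v huv => ?_
    have hC : (.inl s : V ⊕ V) ∈ C := ⟨hx, by simp⟩
    by_cases hu : u = .inr s
    · subst hu
      rcases v with t | t
      · obtain rfl := hD.eq_of_adj_inr_inl _ _ huv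
        exact Or.inr hC
      · exact (hD.not_adj_inr_inr _ _ huv).elim
    by_cases hv : v = .inr s
    · subst hv
      rcases u with t | t
      · obtain rfl := hD.eq_of_adj_inl_inr _ _ huv
        exact Or.inl hC
      · exact (hD.not_adj_inr_inr _ _ huv).elim
    exact (mem_or_mem_of_adj hP.1.2 huv).imp (fun h => ⟨h, hu⟩) (fun h => ⟨h, hv⟩)
  rw [hPC, X_mem_span_X_image] at hy
  exact hy.2 rfl

/-- A prime which contains the edge ideal contains a vertex of every whisker. -/
lemma IsWhiskered.exists_section (hD : D.IsWhiskered) {P : Ideal (MvPolynomial (V ⊕ V) K)}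
    [hP : P.IsPrime] (hI : D.edgeIdeal K ≤ P) :
    ∃ c : V → V ⊕ V, (∀ s, c s = .inl s ∨ c s = .inr s) ∧ ∀ s, X (c s) ∈ P := by
  have : ∀ s, ∃ v : V ⊕ V, (v = .inl s ∨ v = .inr s) ∧ X v ∈ P := by
    intro s
    rcases hD.mem_or_mem hI s with h | h
    · exact ⟨_, Or.inl rfl, h⟩
    · exact ⟨_, Or.inr rfl, h⟩
  choose c hc using this
  exact ⟨c, fun s => (hc s).1, fun s => (hc s).2⟩

lemma injective_of_section {c : V → V ⊕ V} (hc : ∀ s, c s = .inl s ∨ c s = .inr s) :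
    Function.Injective c := by
  intro s t hst
  rcases hc s with h | h <;> rcases hc t with h' | h' <;> rw [h, h'] at hst <;>
    first | exact Sum.inl.inj hst | exact Sum.inr.inj hst | cases hst

lemma IsWhiskered.height_eq_card [Fintype V] (hD : D.IsWhiskered)
    {P : Ideal (MvPolynomial (V ⊕ V) K)} (hP : P ∈ (D.edgeIdeal K).minimalPrimes) :
    P.height = Fintype.card V := by
  classical
  have := hP.1.1
  obtain ⟨c, hc, hcP⟩ := hD.exists_section hP.1.2
  have hcard : (Finset.univ.image c).card = Fintype.card V :=
    Finset.card_image_of_injective _ (injective_of_section hc)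
  have hmem : ∀ v, X v ∈ P → v ∈ Finset.univ.image c := by
    intro v hv
    rw [Finset.mem_image]
    rcases v with s | s
    · refine ⟨s, Finset.mem_univ _, (hc s).resolve_right fun h => ?_⟩
      exact hD.not_mem_and_mem hP s ⟨hv, h ▸ hcP s⟩
    · refine ⟨s, Finset.mem_univ _, (hc s).resolve_left fun h => ?_⟩
      exact hD.not_mem_and_mem hP s ⟨h ▸ hcP s, hv⟩
  apply le_antisymm
  · rw [eq_span_X_of_mem_minimalPrimes hP (C := (Finset.univ.image c : Finset (V ⊕ V))), ← hcard]
    · exact height_span_X_image_le _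
    · intro v hv
      obtain ⟨s, -, rfl⟩ := Finset.mem_image.mp (Finset.mem_coe.mp hv)
      exact hcP s
    · intro u v huv
      exact (mem_or_mem_of_adj hP.1.2 huv).imp (hmem u) (hmem v)
  · rw [← hcard]
    refine card_le_height P _ fun v hv => ?_
    obtain ⟨s, -, rfl⟩ := Finset.mem_image.mp hv
    exact hcP s

lemma IsWhiskered.card_lt_height [Fintype V] (hD : D.IsWhiskered)
    {P : Ideal (MvPolynomial (V ⊕ V) K)} [P.IsPrime] (hI : D.edgeIdeal K ≤ P) {s : V}
    (hx : X (.inl s) ∈ P) (hy : X (.inr s) ∈ P) :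
    (Fintype.card V : ℕ∞) < P.height := by
  classical
  obtain ⟨c, hc, hcP⟩ := hD.exists_section hI
  have hcard : (Finset.univ.image c).card = Fintype.card V :=
    Finset.card_image_of_injective _ (injective_of_section hc)
  obtain ⟨v, hv, hvc⟩ : ∃ v : V ⊕ V, X v ∈ P ∧ v ∉ Finset.univ.image c := by
    have key : ∀ t v, (v = .inl s ∨ v = .inr s) → c t = v → t = s := by
      rintro t v (rfl | rfl) h <;> rcases hc t with h' | h' <;> rw [h'] at h <;>
        first | exact Sum.inl.inj h | exact Sum.inr.inj h | cases h
    rcases hc s with h | h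
    · refine ⟨_, hy, fun hm => ?_⟩
      obtain ⟨t, -, ht⟩ := Finset.mem_image.mp hm
      obtain rfl := key t _ (Or.inr rfl) ht
      simp [h] at ht
    · refine ⟨_, hx, fun hm => ?_⟩
      obtain ⟨t, -, ht⟩ := Finset.mem_image.mp hm
      obtain rfl := key t _ (Or.inl rfl) ht
      simp [h] at ht
  have h1 := card_le_height P (insert v (Finset.univ.image c)) fun u hu => by
    rcases Finset.mem_insert.mp hu with rfl | hu
    · exact hv
    · obtain ⟨t, -, rfl⟩ := Finset.mem_image.mp hu
      exact hcP t
  rw [Finset.card_insert_of_notMem hvc, hcard] at h1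
  refine lt_of_lt_of_le ?_ h1
  exact_mod_cast Nat.lt_succ_self _

variable (K)

/-- The prime comes from the annihilator of the class of `x_t * x_s ^ (ω(x_s) - 1) * y_s ^ (ω(y_s) -
1)`, where `x_t → x_s`; such a `t` exists because `x_s` is not a source. -/
lemma IsWhiskered.exists_associatedPrime [Finite V] (hD : D.IsWhiskered)
    (hsource : ∀ v, D.IsSource v → D.weight v = 1) {s : V} (h : D.Adj (.inl s) (.inr s))
    (hw : D.weight (.inl s) ≠ 1) :
    ∃ P ∈ associatedPrimes (MvPolynomial (V ⊕ V) K) (MvPolynomial (V ⊕ V) K ⧸ D.edgeIdeal K),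
      D.edgeIdeal K ≤ P ∧ X (.inl s) ∈ P ∧ X (.inr s) ∈ P := by
  classical
  obtain ⟨u, hu⟩ := exists_adj_of_weight_ne_one hsource h hw
  obtain ⟨t, rfl⟩ : ∃ t, u = .inl t := by
    rcases u with t | t
    · exact ⟨t, rfl⟩
    · obtain rfl := hD.eq_of_adj_inr_inl _ _ hu
      exact (D.asymm _ _ hu h).elim
  have hts : t ≠ s := by
    rintro rfl
    exact D.loopless _ hu
  have hws := D.weight_pos (.inl s)
  have hwy := D.weight_pos (.inr s)
  let m : V ⊕ V →₀ ℕ := Finsupp.single (.inl t) 1 +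
    Finsupp.single (.inl s) (D.weight (.inl s) - 1) +
    Finsupp.single (.inr s) (D.weight (.inr s) - 1)
  have hm : monomial m (1 : K) ∉ D.edgeIdeal K := by
    rw [monomial_mem_edgeIdeal]
    rintro ⟨a, b, hab, hle⟩
    have hb := hle b
    have ha := hle a
    have hne : a ≠ b := by
      rintro rfl
      exact D.loopless _ hab
    have hbw := D.weight_pos b
    simp only [m, edgeExponent, Finsupp.add_apply, Finsupp.single_apply, hne, hne.symm,
      if_true, if_false] at ha hb
    have hmem : ∀ c, (c = Sum.inl t ∨ c = Sum.inl s ∨ c = Sum.inr s) ∨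
        ((if Sum.inl t = c then 1 else 0) + (if Sum.inl s = c then D.weight (Sum.inl s) - 1 else 0) +
          (if Sum.inr s = c then D.weight (Sum.inr s) - 1 else 0) = 0) := by
      intro c
      by_cases h1 : Sum.inl t = c
      · exact Or.inl (Or.inl h1.symm)
      by_cases h2 : Sum.inl s = c
      · exact Or.inl (Or.inr (Or.inl h2.symm))
      by_cases h3 : Sum.inr s = c
      · exact Or.inl (Or.inr (Or.inr h3.symm))
      simp [h1, h2, h3]
    -- An edge whose generator divides `m` has both ends among `x_t`, `x_s`, `y_s`. A head `x_s` or
    -- `y_s` fails because its exponent in `m` is one too small; a head `x_t` would require a loop,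
    -- an edge opposite to `x_t → x_s`, or a second neighbor of `y_s`.
    rcases hmem a with ha' | ha'
    · rcases hmem b with hb' | hb'
      · rcases hb' with rfl | rfl | rfl
        · rcases ha' with rfl | rfl | rfl
          · exact hne rfl
          · exact D.asymm _ _ hab hu
          · exact hts (hD.eq_of_adj_inr_inl _ _ hab).symm
        · simp [hts] at hb
          omega
        · simp at hb
          omega
      · omega
    · omega
  obtain ⟨P, hP, hle⟩ := exists_le_isAssociatedPrime_of_isNoetherianRing
    (MvPolynomial (V ⊕ V) K) (Ideal.Quotient.mk (D.edgeIdeal K) (monomial m 1))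
    (by rwa [Ne, Ideal.Quotient.eq_zero_iff_mem])
  have hmem : ∀ p, p * monomial m 1 ∈ D.edgeIdeal K → p ∈ P := by
    intro p hp
    refine hle ?_
    rw [Submodule.mem_colon_singleton, Submodule.mem_bot]
    exact Ideal.Quotient.eq_zero_iff_mem.mpr hp
  refine ⟨P, hP, fun p hp => hmem p (Ideal.mul_mem_right _ _ hp), hmem _ ?_, hmem _ ?_⟩
  · rw [X, monomial_mul, one_mul, monomial_mem_edgeIdeal]
    refine ⟨_, _, hu, fun i => ?_⟩
    simp only [m, edgeExponent, Finsupp.add_apply, Finsupp.single_apply]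
    split_ifs <;> omega
  -- Divisibility by `x_s * y_s ^ ω(y_s)` needs `ω(x_s) - 1 ≥ 1`, which is where `hw` enters.
  · rw [X, monomial_mul, one_mul, monomial_mem_edgeIdeal]
    refine ⟨_, _, h, fun i => ?_⟩
    simp only [m, edgeExponent, Finsupp.add_apply, Finsupp.single_apply]
    split_ifs <;> omega

theorem IsWhiskered.weight_eq_one_of_isCohenMacaulay [Finite V] (hD : D.IsWhiskered)
    (hsource : ∀ v, D.IsSource v → D.weight v = 1) (hCM : D.IsCohenMacaulay K) (s : V)
    (h : D.Adj (.inl s) (.inr s)) : D.weight (.inl s) = 1 := by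
  by_contra hw
  obtain ⟨P, hP, -, hx, hy⟩ := hD.exists_associatedPrime K hsource h hw
  exact hD.not_mem_and_mem (hCM.mem_minimalPrimes hP) s ⟨hx, hy⟩

theorem IsWhiskered.isUnmixedIdeal_of_isCohenMacaulay [Finite V] (hD : D.IsWhiskered)
    (hCM : D.IsCohenMacaulay K) : (D.edgeIdeal K).IsUnmixedIdeal := by
  have := Fintype.ofFinite V
  intro P hP Q hQ
  rw [hD.height_eq_card (hCM.mem_minimalPrimes hP), hD.height_eq_card (hCM.mem_minimalPrimes hQ)]

theorem IsWhiskered.weight_eq_one_of_isUnmixedIdeal [Finite V] (hD : D.IsWhiskered)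
    (hsource : ∀ v, D.IsSource v → D.weight v = 1) (hI : (D.edgeIdeal K).IsUnmixedIdeal) (s : V)
    (h : D.Adj (.inl s) (.inr s)) : D.weight (.inl s) = 1 := by
  have := Fintype.ofFinite V
  by_contra hw
  obtain ⟨P, hP, hIP, hx, hy⟩ := hD.exists_associatedPrime K hsource h hw
  have hprime : P.IsPrime := IsAssociatedPrime.isPrime hP
  obtain ⟨Q, hQ, -⟩ := Ideal.exists_minimalPrimes_le hIP
  have hQ' : Q ∈ associatedPrimes (MvPolynomial (V ⊕ V) K)
      (MvPolynomial (V ⊕ V) K ⧸ D.edgeIdeal K) := by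
    apply Module.associatedPrimes.minimalPrimes_annihilator_subset_associatedPrimes
    rwa [Ideal.annihilator_quotient]
  have := hD.card_lt_height hIP hx hy
  rw [hI P hP Q hQ', hD.height_eq_card hQ] at this
  exact lt_irrefl _ this

end Unmixed

end WeightedOrientedGraph

/-! ### Linear quotients for ideals of transversals -/

section LinearQuotients

variable {K : Type*} [Field K] {Z V : Type*} [Fintype V]

/-- The exponent vector of the product of the variables `c t`. -/
noncomputable def sectionExponent (c : V → Z) : Z →₀ ℕ :=
  ∑ t, Finsupp.single (c t) 1

lemma sectionExponent_ne_zero_iff {c : V → Z} {z : Z} :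
    sectionExponent c z ≠ 0 ↔ ∃ t, c t = z := by
  classical
  simp [sectionExponent, Finsupp.finsetSum_apply, Finsupp.single_apply]

lemma sectionExponent_le_iff {base : Z → V} {c : V → Z} (hc : ∀ t, base (c t) = t)
    {b : Z →₀ ℕ} : sectionExponent c ≤ b ↔ ∀ t, b (c t) ≠ 0 := by
  classical
  constructor
  · intro h t hb
    have := h (c t)
    rw [hb, nonpos_iff_eq_zero] at this
    exact sectionExponent_ne_zero_iff.mpr ⟨t, rfl⟩ this
  · intro h z
    by_cases hz : ∃ t, c t = z
    · obtain ⟨t, rfl⟩ := hz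
      have : sectionExponent c (c t) = 1 := by
        rw [sectionExponent, Finsupp.finsetSum_apply, Finset.sum_eq_single t]
        · simp
        · intro s _ hs
          rw [Finsupp.single_eq_of_ne]
          intro h
          exact hs (by rw [← hc s, ← hc t, h])
        · simp
      rw [this]
      exact Nat.one_le_iff_ne_zero.mpr (h t)
    · rw [← sectionExponent_ne_zero_iff, not_not] at hz
      rw [hz]
      exact Nat.zero_le _

/-- The sections of `base` which meet every set of the family `𝓗`. -/
def TransversalSection (base : Z → V) (𝓗 : Set (Set Z)) : Type _ :=
  {c : V → Z // (∀ t, base (c t) = t) ∧ ∀ H ∈ 𝓗, ∃ t, c t ∈ H}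

variable {base : Z → V} {rank : Z → ℕ} {𝓗 : Set (Set Z)} {L : Ideal (MvPolynomial Z K)}

lemma TransversalSection.injective_sectionExponent :
    Function.Injective fun c : TransversalSection base 𝓗 => sectionExponent c.1 := by
  intro c d h
  refine Subtype.ext (funext fun t => ?_)
  have : sectionExponent d.1 (c.1 t) ≠ 0 := by
    rw [← show sectionExponent c.1 = sectionExponent d.1 from h]
    exact sectionExponent_ne_zero_iff.mpr ⟨t, rfl⟩
  obtain ⟨s, hs⟩ := sectionExponent_ne_zero_iff.mp this
  have hst : s = t := by rw [← d.2.1 s, hs, c.2.1 t]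
  rw [← hs, hst]

/-- A section is minimal since every fiber has to be met. Conversely, keeping only the lowest
variable of a transversal in each fiber leaves a transversal, by `hdown`. -/
lemma minGens_eq_range_sectionExponent
    (hdown : ∀ H ∈ 𝓗, ∀ z ∈ H, ∀ z', base z' = base z → rank z' ≤ rank z → z' ∈ H)
    (hfib : ∀ t, {z | base z = t} ∈ 𝓗)
    (hL : ∀ b, monomial b (1 : K) ∈ L ↔ ∀ H ∈ 𝓗, ∃ z ∈ H, b z ≠ 0) :
    Set.range (fun c : TransversalSection base 𝓗 => sectionExponent c.1) = minGens L := by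
  have hmem : ∀ c : TransversalSection base 𝓗, monomial (sectionExponent c.1) (1 : K) ∈ L := by
    intro c
    rw [hL]
    intro H hH
    obtain ⟨t, ht⟩ := c.2.2 H hH
    exact ⟨_, ht, sectionExponent_ne_zero_iff.mpr ⟨t, rfl⟩⟩
  ext b
  constructor
  · rintro ⟨c, rfl⟩
    refine ⟨hmem c, fun b hb hbc => ?_⟩
    rw [sectionExponent_le_iff c.2.1]
    intro t
    obtain ⟨z, hz, hbz⟩ := (hL b).mp hb _ (hfib t)
    have hcz : sectionExponent c.1 z ≠ 0 := fun h => hbz (by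
      have := hbc z
      rwa [show (fun c : TransversalSection base 𝓗 => sectionExponent c.1) c z = 0 from h,
        nonpos_iff_eq_zero] at this)
    obtain ⟨s, rfl⟩ := sectionExponent_ne_zero_iff.mp hcz
    have : s = t := by rw [← c.2.1 s]; exact hz
    rwa [← this]
  · rintro ⟨hb, hmin⟩
    have hex : ∀ t, ∃ z, (base z = t ∧ b z ≠ 0) ∧ ∀ z', base z' = t → b z' ≠ 0 →
        rank z ≤ rank z' := by
      intro t
      obtain ⟨z, hz, hbz⟩ := (hL b).mp hb _ (hfib t)
      obtain ⟨z₀, hz₀, hle⟩ := exists_minimalFor_of_wellFoundedLT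
        (fun z => base z = t ∧ b z ≠ 0) rank ⟨z, hz, hbz⟩
      exact ⟨z₀, hz₀, fun z' h1 h2 => (le_total _ _).elim id (hle ⟨h1, h2⟩)⟩
    choose c hc hcmin using hex
    have hhit : ∀ H ∈ 𝓗, ∃ t, c t ∈ H := by
      intro H hH
      obtain ⟨z, hz, hbz⟩ := (hL b).mp hb H hH
      exact ⟨base z, hdown H hH z hz _ (hc _).1 (hcmin _ z rfl hbz)⟩
    let c' : TransversalSection base 𝓗 := ⟨c, fun t => (hc t).1, hhit⟩
    have hle : sectionExponent c ≤ b := (sectionExponent_le_iff c'.2.1).mpr fun t => (hc t).2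
    exact ⟨c', le_antisymm hle (hmin (hmem c') hle)⟩

/-- An ideal whose monomials are the transversals of a family of sets, which contains the fibers of
`base` and whose members are closed under lowering the rank in a fiber, has linear quotients. -/
theorem hasLinearQuotients_of_transversals [Finite Z]
    (hrank : ∀ z z', base z = base z' → rank z = rank z' → z = z')
    (hdown : ∀ H ∈ 𝓗, ∀ z ∈ H, ∀ z', base z' = base z → rank z' ≤ rank z → z' ∈ H)
    (hfib : ∀ t, {z | base z = t} ∈ 𝓗)
    (hL : ∀ b, monomial b (1 : K) ∈ L ↔ ∀ H ∈ 𝓗, ∃ z ∈ H, b z ≠ 0) :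
    HasLinearQuotients L := by
  classical
  have : Finite (TransversalSection base 𝓗) := Subtype.finite
  have := Fintype.ofFinite (TransversalSection base 𝓗)
  let e₀ := (Fintype.equivFin (TransversalSection base 𝓗)).symm
  -- The generators are ordered by total rank, with ties broken arbitrarily.
  let ht : TransversalSection base 𝓗 → ℕ := fun c => ∑ t, rank (c.1 t)
  let σ := Tuple.sort (ht ∘ e₀)
  let e : Fin _ ≃ TransversalSection base 𝓗 := σ.trans e₀
  have hmono : Monotone (ht ∘ e) := Tuple.monotone_sort (ht ∘ e₀)
  refine ⟨_, fun i => sectionExponent (e i).1,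
    TransversalSection.injective_sectionExponent.comp e.injective, ?_, fun i _ => ?_⟩
  · rw [← minGens_eq_range_sectionExponent hdown hfib hL]
    exact e.surjective.range_comp fun c => sectionExponent c.1
  · refine ⟨{z | rank z < rank ((e i).1 (base z))}, ?_⟩
    have hspan : {f | ∃ u, u < i ∧ f = monomial (sectionExponent (e u).1) (1 : K)} =
        (fun a => monomial a (1 : K)) '' {a | ∃ u, u < i ∧ a = sectionExponent (e u).1} := by
      ext f
      constructor
      · rintro ⟨u, hu, rfl⟩
        exact ⟨_, ⟨u, hu, rfl⟩, rfl⟩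
      · rintro ⟨_, ⟨u, hu, rfl⟩, rfl⟩
        exact ⟨u, hu, rfl⟩
    rw [hspan]
    have hcolon : ∀ p, p ∈ Submodule.colon (Ideal.span ((fun a => monomial a (1 : K)) ''
        {a | ∃ u, u < i ∧ a = sectionExponent (e u).1}))
        (Ideal.span {monomial (sectionExponent (e i).1) (1 : K)} : Ideal (MvPolynomial Z K)) ↔
        p * monomial (sectionExponent (e i).1) 1 ∈ Ideal.span ((fun a => monomial a (1 : K)) ''
        {a | ∃ u, u < i ∧ a = sectionExponent (e u).1}) := by
      intro p
      rw [Ideal.mem_colon_span_singleton]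
    apply le_antisymm
    · intro p hp
      rw [hcolon, mem_ideal_span_monomial_image] at hp
      rw [mem_ideal_span_X_image]
      intro a ha
      obtain ⟨_, ⟨u, hu, rfl⟩, hle⟩ := hp (a + sectionExponent (e i).1) (by
        rw [mem_support_iff, coeff_mul_monomial, mul_one]
        exact mem_support_iff.mp ha)
      -- An earlier section has no larger total rank. Were it nowhere lower, all ranks would agree
      -- and the two sections would coincide by `hrank`.
      have hlt : ∃ t, rank ((e u).1 t) < rank ((e i).1 t) := by
        by_contra! hge
        have h1 : ht (e u) ≤ ht (e i) := hmono hu.le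
        have h2 : ∀ t ∈ Finset.univ, rank ((e i).1 t) = rank ((e u).1 t) :=
          (Finset.sum_eq_sum_iff_of_le fun t _ => hge t).mp
            (le_antisymm (Finset.sum_le_sum fun t _ => hge t) h1)
        have h3 : e u = e i := Subtype.ext (funext fun t =>
          hrank _ _ (by rw [(e u).2.1, (e i).2.1]) (h2 t (Finset.mem_univ t)).symm)
        exact hu.ne (e.injective h3)
      obtain ⟨t, hlt⟩ := hlt
      refine ⟨(e u).1 t, ?_, fun ha0 => ?_⟩
      · rw [Set.mem_ofPred_eq, (e u).2.1]
        exact hlt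
      · have h1 := hle ((e u).1 t)
        rw [Finsupp.add_apply, ha0, zero_add] at h1
        have h2 : sectionExponent (e u).1 ((e u).1 t) ≠ 0 :=
          sectionExponent_ne_zero_iff.mpr ⟨t, rfl⟩
        obtain ⟨s, hs⟩ := sectionExponent_ne_zero_iff.mp
          (fun h0 => h2 (nonpos_iff_eq_zero.mp (h0 ▸ h1)))
        have hst : s = t := by rw [← (e i).2.1 s, hs, (e u).2.1]
        rw [hst] at hs
        rw [hs] at hlt
        exact lt_irrefl _ hlt
    · rw [Ideal.span_le]
      rintro _ ⟨z, hz, rfl⟩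
      rw [SetLike.mem_coe, hcolon, X, monomial_mul, one_mul]
      -- Exchanging one pick for the lower `z` preserves transversality and strictly lowers the
      -- total rank, so the new section comes earlier.
      let c : V → Z := Function.update (e i).1 (base z) z
      have hcs : c (base z) = z := Function.update_self ..
      have hct : ∀ t, t ≠ base z → c t = (e i).1 t := fun t h => Function.update_of_ne h ..
      have hcb : ∀ t, base (c t) = t := by
        intro t
        by_cases h : t = base z
        · rw [h, hcs]
        · rw [hct t h, (e i).2.1]
      have hcH : ∀ H ∈ 𝓗, ∃ t, c t ∈ H := by
        intro H hH
        obtain ⟨t, htH⟩ := (e i).2.2 H hH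
        refine ⟨t, ?_⟩
        by_cases h : t = base z
        · rw [h, hcs]
          rw [h] at htH
          exact hdown H hH _ htH z ((e i).2.1 _).symm (le_of_lt hz)
        · rwa [hct t h]
      let c' : TransversalSection base 𝓗 := ⟨c, hcb, hcH⟩
      have hlt : ht c' < ht (e i) := by
        refine Finset.sum_lt_sum (fun t _ => ?_) ⟨base z, Finset.mem_univ _, ?_⟩
        · change rank (c t) ≤ _
          by_cases h : t = base z
          · rw [h, hcs]
            exact le_of_lt hz
          · rw [hct t h]
        · change rank (c _) < _
          rw [hcs]
          exact hz
      have hidx : e.symm c' < i := by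
        by_contra! hge
        have := hmono hge
        simp only [Function.comp_apply, Equiv.apply_symm_apply] at this
        omega
      refine Ideal.mem_of_dvd _ (a := monomial (sectionExponent c) (1 : K)) ?_
        (Ideal.subset_span ⟨_, ⟨e.symm c', hidx, rfl⟩, ?_⟩)
      · rw [monomial_dvd_monomial]
        refine ⟨Or.inr ((sectionExponent_le_iff hcb).mpr fun t => ?_), dvd_rfl⟩
        rw [Finsupp.add_apply]
        by_cases h : t = base z
        · rw [h, hcs, Finsupp.single_eq_same]
          omega
        · rw [hct t h]
          have : sectionExponent (e i).1 ((e i).1 t) ≠ 0 :=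
            sectionExponent_ne_zero_iff.mpr ⟨t, rfl⟩
          omega
      · beta_reduce
        rw [e.apply_symm_apply]

end LinearQuotients

/-! ### Monomials in the Alexander dual of a polarization -/

section Polarization

variable {K : Type*} [Field K]

/-- Any monomial generating set may replace the minimal one, since enlarging a support only makes it
easier to meet. -/
lemma monomial_mem_alexanderDual_span {σ : Type*} (A : Set (σ →₀ ℕ)) (b : σ →₀ ℕ) :
    monomial b (1 : K) ∈ alexanderDual (Ideal.span ((fun a => monomial a (1 : K)) '' A)) ↔
      ∀ a ∈ A, ∃ i, a i ≠ 0 ∧ b i ≠ 0 := by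
  classical
  have hspan : ∀ a : σ →₀ ℕ, {f : MvPolynomial σ K | ∃ i, a i ≠ 0 ∧ f = X i} =
      X '' {i | a i ≠ 0} := by
    intro a
    ext f
    simp [eq_comm]
  have hmem : ∀ c : σ →₀ ℕ, monomial c (1 : K) ∈
      Ideal.span ((fun a => monomial a (1 : K)) '' A) ↔ ∃ a ∈ A, a ≤ c := by
    intro c
    rw [mem_ideal_span_monomial_image]
    simp [support_monomial]
  have hdual : monomial b (1 : K) ∈
      alexanderDual (Ideal.span ((fun a => monomial a (1 : K)) '' A)) ↔
      ∀ a ∈ minGens (Ideal.span ((fun a => monomial a (1 : K)) '' A)), ∃ i, a i ≠ 0 ∧ b i ≠ 0 := by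
    simp only [alexanderDual, Ideal.mem_iInf, hspan, mem_ideal_span_X_image]
    simp [support_monomial]
  rw [hdual]
  constructor
  · intro h a ha
    obtain ⟨c, hca, hc⟩ := exists_minimal_le_of_wellFoundedLT
      (fun c => monomial c (1 : K) ∈ Ideal.span ((fun a => monomial a (1 : K)) '' A)) a
      ((hmem a).mpr ⟨a, ha, le_rfl⟩)
    obtain ⟨i, hci, hbi⟩ := h c hc
    exact ⟨i, fun h0 => hci (nonpos_iff_eq_zero.mp (h0 ▸ hca i)), hbi⟩
  · intro h a ha
    obtain ⟨c, hc, hca⟩ := (hmem a).mp ha.1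
    obtain ⟨i, hci, hbi⟩ := h c hc
    exact ⟨i, fun h0 => hci (nonpos_iff_eq_zero.mp (h0 ▸ hca i)), hbi⟩

lemma monomial_mem_alexanderDual_polarization {σ : Type*} [Fintype σ]
    (I : Ideal (MvPolynomial σ K)) (b : (Σ i : σ, Fin (maxExponent I i)) →₀ ℕ) :
    monomial b (1 : K) ∈ alexanderDual (polarization I) ↔
      ∀ a ∈ minGens I, ∃ z : Σ i : σ, Fin (maxExponent I i), z.2.val < a z.1 ∧ b z ≠ 0 := by
  classical
  let pol : (σ →₀ ℕ) → ((Σ i : σ, Fin (maxExponent I i)) →₀ ℕ) := fun a =>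
    ∑ i : σ, ∑ j : Fin (maxExponent I i) with j.val < a i, Finsupp.single ⟨i, j⟩ 1
  have hpol : ∀ a z, pol a z ≠ 0 ↔ z.2.val < a z.1 := by
    rintro a ⟨i, j⟩
    have : pol a ⟨i, j⟩ = if j.val < a i then 1 else 0 := by
      simp only [pol, Finsupp.finsetSum_apply]
      rw [Finset.sum_eq_single i]
      · simp [Finsupp.single_apply, Finset.sum_ite_eq']
      · intro k _ hk
        refine Finset.sum_eq_zero fun l _ => Finsupp.single_eq_of_ne fun h => hk ?_
        exact (congrArg Sigma.fst h).symm
      · simp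
    rw [this]
    simp
  have hspan : polarization I =
      Ideal.span ((fun a => monomial a (1 : K)) '' (pol '' minGens I)) := by
    rw [polarization, Set.image_image]
    congr 1
    refine Set.image_congr fun a _ => ?_
    simp only [pol, monomial_sum_one]
    rfl
  rw [hspan, monomial_mem_alexanderDual_span, Set.forall_mem_image]
  simp only [hpol]

end Polarization

/-! ### Polarized edge ideals have dual linear quotients -/

namespace WeightedOrientedGraph

section

variable {W : Type*} (D : WeightedOrientedGraph W) (K : Type*) [Field K]

lemma Adj.ne {D : WeightedOrientedGraph W} {u v : W} (h : D.Adj u v) : u ≠ v := by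
  rintro rfl
  exact D.loopless _ h

open Classical in
lemma Adj.edgeExponent_apply {D : WeightedOrientedGraph W} {u v : W} (h : D.Adj u v) (i : W) :
    D.edgeExponent u v i = if i = u then 1 else if i = v then D.weight v else 0 := by
  have hne := Adj.ne h
  simp only [edgeExponent, Finsupp.add_apply, Finsupp.single_apply, eq_comm (b := i)]
  by_cases hu : i = u
  · subst hu
    simp [hne]
  · simp [hu]

lemma Adj.edgeExponent_ne_zero_iff {D : WeightedOrientedGraph W} {u v : W} (h : D.Adj u v)
    {i : W} : D.edgeExponent u v i ≠ 0 ↔ i = u ∨ i = v := by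
  have := (D.weight_pos v).ne'
  rw [Adj.edgeExponent_apply h]
  split_ifs <;> simp_all

/-- The support of a generator is the two-element set of ends of its edge, so divisibility between
generators forces equal edges, opposite edges being excluded. -/
lemma minGens_edgeIdeal :
    minGens (D.edgeIdeal K) = {a | ∃ u v, D.Adj u v ∧ a = D.edgeExponent u v} := by
  have hanti : ∀ u v u' v', D.Adj u v → D.Adj u' v' →
      D.edgeExponent u v ≤ D.edgeExponent u' v' → u = u' ∧ v = v' := by
    intro u v u' v' h h' hle
    have key : ∀ i, i = u ∨ i = v → i = u' ∨ i = v' := by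
      intro i hi
      rw [← Adj.edgeExponent_ne_zero_iff h] at hi
      rw [← Adj.edgeExponent_ne_zero_iff h']
      have := hle i
      omega
    have hne := Adj.ne h
    rcases key u (Or.inl rfl) with rfl | rfl <;> rcases key v (Or.inr rfl) with rfl | rfl
    · exact (hne rfl).elim
    · exact ⟨rfl, rfl⟩
    · exact (D.asymm _ _ h h').elim
    · exact (hne rfl).elim
  ext a
  constructor
  · rintro ⟨ha, hmin⟩
    obtain ⟨u, v, h, hle⟩ := (D.monomial_mem_edgeIdeal K).mp ha
    exact ⟨u, v, h, le_antisymm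
      (hmin ((D.monomial_mem_edgeIdeal K).mpr ⟨u, v, h, le_rfl⟩) hle) hle⟩
  · rintro ⟨u, v, h, rfl⟩
    refine ⟨(D.monomial_mem_edgeIdeal K).mpr ⟨u, v, h, le_rfl⟩, fun b hb hle => ?_⟩
    obtain ⟨u', v', h', hle'⟩ := (D.monomial_mem_edgeIdeal K).mp hb
    obtain ⟨rfl, rfl⟩ := hanti _ _ _ _ h' h (hle'.trans hle)
    exact hle'

/-- A vertex with an incoming edge attains its weight there. A source occurs only with exponent 1,
which is its weight by `hsource`. -/
lemma maxExponent_edgeIdeal (hsource : ∀ v, D.IsSource v → D.weight v = 1) (i : W)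
    (hi : ∃ u, D.Adj u i ∨ D.Adj i u) : maxExponent (D.edgeIdeal K) i = D.weight i := by
  classical
  have hpos := D.weight_pos i
  rw [maxExponent, minGens_edgeIdeal]
  refine IsGreatest.csSup_eq ⟨?_, ?_⟩
  · by_cases hin : ∃ u, D.Adj u i
    · obtain ⟨u, hu⟩ := hin
      refine ⟨_, ⟨u, i, hu, rfl⟩, ?_⟩
      simp [Adj.edgeExponent_apply hu, (Adj.ne hu).symm]
    · obtain ⟨u, hu⟩ := hi
      have hu := hu.resolve_left fun h => hin ⟨u, h⟩
      refine ⟨_, ⟨i, u, hu, rfl⟩, ?_⟩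
      simp [Adj.edgeExponent_apply hu, hsource i ⟨⟨u, hu⟩, not_exists.mp hin⟩]
  · rintro _ ⟨_, ⟨u, v, h, rfl⟩, rfl⟩
    simp only [Adj.edgeExponent_apply h]
    split_ifs with h1 h2
    · exact hpos
    · rw [h2]
    · exact hpos.le

end

section DualLinearQuotients

variable {V : Type*} {D : WeightedOrientedGraph (V ⊕ V)}

open Classical in
-- An edge at `y_s` is the whisker, whose tail has weight 1. Both ends thus carry their full weight,
-- and the polarized generator is the product of the entire fiber over `s`.
lemma IsWhiskered.edgeExponent_apply_of_inr (hD : D.IsWhiskered)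
    (hsource : ∀ v, D.IsSource v → D.weight v = 1)
    (hw : ∀ s : V, D.Adj (.inl s) (.inr s) → D.weight (.inl s) = 1) {u v : V ⊕ V} {s : V}
    (h : D.Adj u v) (hs : .inr s = u ∨ .inr s = v) (i : V ⊕ V) :
    D.edgeExponent u v i = if i.elim id id = s then D.weight i else 0 := by
  rw [Adj.edgeExponent_apply h]
  rcases hs with rfl | rfl
  · rcases v with t | t
    · obtain rfl := hD.eq_of_adj_inr_inl _ _ h
      have := hD.weight_inr_eq_one hsource h
      rcases i with i | i <;> simp <;> split_ifs <;> simp_all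
    · exact (hD.not_adj_inr_inr _ _ h).elim
  · rcases u with t | t
    · obtain rfl := hD.eq_of_adj_inl_inr _ _ h
      have := hw _ h
      rcases i with i | i <;> simp <;> split_ifs <;> simp_all
    · exact (hD.not_adj_inr_inr _ _ h).elim

theorem IsWhiskered.hasDualLinearQuotients_polarization (K : Type*) [Field K] [Fintype V]
    (hD : D.IsWhiskered)
    (hsource : ∀ v, D.IsSource v → D.weight v = 1)
    (hw : ∀ s : V, D.Adj (.inl s) (.inr s) → D.weight (.inl s) = 1) :
    HasDualLinearQuotients (polarization (D.edgeIdeal K)) := by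
  classical
  have hmax : ∀ i, maxExponent (D.edgeIdeal K) i = D.weight i := fun i =>
    D.maxExponent_edgeIdeal K hsource i (hD.exists_adj i)
  have hlt : ∀ i (j : Fin (maxExponent (D.edgeIdeal K) i)), j.val < D.weight i := fun i j =>
    j.2.trans_eq (hmax i)
  have hexp := fun u v s => hD.edgeExponent_apply_of_inr hsource hw (u := u) (v := v) (s := s)
  refine hasLinearQuotients_of_transversals
    (Z := Σ i : V ⊕ V, Fin (maxExponent (D.edgeIdeal K) i))
    (base := fun z => z.1.elim id id)
    -- The shift by `ω(x_t)` places all polarization variables of `x_t` before those of `y_t`.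
    (rank := fun z => z.1.elim (fun _ => z.2.val) fun t => D.weight (.inl t) + z.2.val)
    (𝓗 := {H | ∃ u v, D.Adj u v ∧ H = {z | z.2.val < D.edgeExponent u v z.1}})
    ?_ ?_ ?_ ?_
  · rintro ⟨s | s, j⟩ ⟨s' | s', j'⟩ hb hr
    · obtain rfl : s = s' := hb
      simpa [Fin.ext_iff] using hr
    · obtain rfl : s = s' := hb
      have := hlt _ j
      simp only [Sum.elim_inl, Sum.elim_inr] at hr
      omega
    · obtain rfl : s = s' := hb
      have := hlt _ j'
      simp only [Sum.elim_inl, Sum.elim_inr] at hr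
      omega
    · obtain rfl : s = s' := hb
      simpa [Fin.ext_iff] using hr
  · rintro _ ⟨u, v, h, rfl⟩ ⟨s | s, j⟩ hz ⟨s' | s', j'⟩ hb hr
    · obtain rfl : s' = s := hb
      exact lt_of_le_of_lt hr hz
    · obtain rfl : s' = s := hb
      have := hlt _ j
      simp only [Sum.elim_inl, Sum.elim_inr] at hr
      omega
    -- A support containing a variable of `y_s` belongs to the whisker, hence contains the whole
    -- fiber, including every variable of `x_s`.
    · obtain rfl : s' = s := hb
      have hne : D.edgeExponent u v (.inr s') ≠ 0 := (Nat.zero_le _).trans_lt hz |>.ne'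
      have hu := (Adj.edgeExponent_ne_zero_iff h).mp hne
      change j'.val < D.edgeExponent u v (.inl s')
      rw [hexp u v s' h hu]
      simpa using hlt _ j'
    · obtain rfl : s' = s := hb
      simp only [Sum.elim_inr, add_le_add_iff_left] at hr
      exact lt_of_le_of_lt hr hz
  · intro t
    have key : ∀ u v, D.Adj u v → (.inr t = u ∨ .inr t = v) →
        {z : Σ i : V ⊕ V, Fin (maxExponent (D.edgeIdeal K) i) | z.1.elim id id = t} =
          {z | z.2.val < D.edgeExponent u v z.1} := by
      intro u v h hu
      ext ⟨i, j⟩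
      simp only [Set.mem_ofPred_eq, hexp u v t h hu]
      have := hlt _ j
      split_ifs with hi <;> simp [hi, this]
    rcases hD.whisker t with h | h
    · exact ⟨_, _, h, key _ _ h (Or.inr rfl)⟩
    · exact ⟨_, _, h, key _ _ h (Or.inl rfl)⟩
  · intro b
    rw [monomial_mem_alexanderDual_polarization, minGens_edgeIdeal]
    constructor
    · rintro h _ ⟨u, v, huv, rfl⟩
      exact h _ ⟨u, v, huv, rfl⟩
    · rintro h _ ⟨u, v, huv, rfl⟩
      exact h _ ⟨u, v, huv, rfl⟩

end DualLinearQuotients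

end WeightedOrientedGraph

theorem mainTheorem6 {K : Type*} [Field K] {V : Type*} [Fintype V]
    (G' : SimpleGraph V) (D : WeightedOrientedGraph (V ⊕ V))
    (hG : D.underlyingGraph = G'.whiskerGraph)
    (hsource : ∀ v, D.IsSource v → D.weight v = 1) :
    List.TFAE [
      D.IsCohenMacaulay K,
      (D.edgeIdeal K).IsUnmixedIdeal,
      ∀ s : V, D.Adj (Sum.inl s) (Sum.inr s) → D.weight (Sum.inl s) = 1] ∧
    (D.IsCohenMacaulay K → HasDualLinearQuotients (polarization (D.edgeIdeal K))) ∧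
    ((D.edgeIdeal K).IsUnmixedIdeal → HasDualLinearQuotients (polarization (D.edgeIdeal K))) ∧
    ((∀ s : V, D.Adj (Sum.inl s) (Sum.inr s) → D.weight (Sum.inl s) = 1) →
      HasDualLinearQuotients (polarization (D.edgeIdeal K))) := by
  have hD := WeightedOrientedGraph.isWhiskered_of_underlyingGraph_eq hG
  have hquot := hD.hasDualLinearQuotients_polarization K hsource
  refine ⟨?_, fun h => hquot (hD.weight_eq_one_of_isCohenMacaulay K hsource h),
    fun h => hquot (hD.weight_eq_one_of_isUnmixedIdeal K hsource h), hquot⟩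
  tfae_have 1 → 2 := hD.isUnmixedIdeal_of_isCohenMacaulay K
  tfae_have 2 → 3 := hD.weight_eq_one_of_isUnmixedIdeal K hsource
  tfae_have 3 → 1 := D.isCohenMacaulay_of_weight_eq_one hD hsource
  tfae_finish
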